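/- Let $\mathcal H$ be a separable infinite-dimensional real Hilbert space and let $\mu_0=\mathcal N(m_0,\Gamma)$ be a Gaussian prior on $\mathcal H$ with self-adjoint, positive definite, trace-class covariance operator $\Gamma$. Let $\mathcal X\subseteq\mathcal H$ be a (continuously embedded) Banach space with $\mu_0(\mathcal X)=1$, and let $F:\mathcal X\to\mathbb R^{N}$ be a forward operator such that (i) for every $\epsilon>0$ there is $K>0$ with $\|F(u)\|\le\exp(K+\epsilon\|u\|_{\mathcal H}^2)$ for all $u\in\mathcal X$; (ii) for every $\epsilon>0$ there is $K>0$ with $\|F(u_1)-F(u_2)\|\le K\|u_1-u_2\|_{\mathcal H}$ whenever $u_1,u_2\in\mathcal X$, $\|u_1\|_{\mathcal H},\|u_2\|_{\mathcal H}<\epsilon$; (iii) for every $u\in\mathcal X$ there is a bounded linear $J(u):\mathcal X\to\mathbb R^N$ with $\|F(u+\delta)-F(u)-J(u)\delta\|/\|\delta\|_{\mathcal H}\to0$ as $\delta\to0$ in $\mathcal X$. For data $y\in\mathbb R^N$ and a positive definite noise covariance $\Gamma_{\rm obs}$ put $\eta(u)=\tfrac12(F(u)-y)^\top\Gamma_{\rm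 obs}^{-1}(F(u)-y)$, let $\mu_y(du)\propto e^{-\eta(u)}\mu_0(du)$ be the posterior, and suppose that $\mu_y$ and $\mu_0$ are mutually absolutely continuous. Write $\nabla\eta(u)\in\mathcal H$ for the gradient of $\eta$ with respect to the inner product of $\mathcal H$. Let $(\psi_i)_{i\in\mathbb N}$ be an orthonormal basis of $\mathcal H$, and let $A,B,G$ be bounded self-adjoint operators on $\mathcal H$ with $A\psi_i=a_i\psi_i$, $B\psi_i=b_i\psi_i$, $G\psi_i=g_i\psi_i$. Let $u_{\rm ref}=m_0+m_{\rm ref}$ with $m_{\rm ref}\in{\rm Im}(\Gamma^{1/2})$, let $\xi\sim\mathcal N(0,I)$ be white noise on $\mathcal H$, and let $q(u,\cdot)$ be the law of $$u'=\Gamma^{1/2}A\,\Gamma^{-1/2}(u-u_{\rm ref})+u_{\rm ref}-\Gamma^{1/2}G\,\Gamma^{1/2}\nabla\eta(u)+\Gamma^{1/2}B\,\xi .$$ Here, for $u\sim\mu_0$, $\Gamma^{-1/2}(u-m_0)$ is understood as white noise with coordinates $\langle\psi_i,\Gamma^{-1/2}(u-m_0)\rangle\in L^2(\mu_0)$, obtained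 by extending the isometry $\Gamma^{1/2}h\mapsto\langle h,u-m_0\rangle$ from ${\rm Im}(\Gamma^{1/2})$ to $\mathcal H$, and $\Gamma^{1/2}A$ and $\Gamma^{1/2}B$ are applied to white noise through the expansion in $(\psi_i)$, with convergence in $L^2$; thus $q(u,\cdot)$ is defined for $\mu_0$-almost every $u$. Suppose that 1. the eigenvalues $a_i,b_i,g_i$ are real and there is $C<\infty$ with $|a_i|,|b_i|,|g_i|<C$ for all $i$; 2. if $b_i=0$ then $a_i=1$ and $g_i=0$; 3. there is $c>0$ with $|b_i|\ge c$ for every $i$ with $b_i\ne0$; 4. $\sum_{i}(a_i^2+b_i^2-1)^2<\infty$. Then the Metropolis–Hastings algorithm with target $\mu_y$ and proposal $q$ is well defined: the series defining $\Gamma^{1/2}A\Gamma^{-1/2}(u-m_0)$ and $\Gamma^{1/2}B\xi$ converge in $L^2$, there is a Markov kernel equal to $q(u,\cdot)$ for $\mu_0$-almost every $u$, and for every such kernel $q$ the measures $$\nu(du,du')=q(u,du')\,\mu_y(du),\qquad \nu^\bot(du,du')=q(u',du)\,\mu_y(du')$$ are mutually absolutely continuous. -/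

import Mathlib

open MeasureTheory ProbabilityTheory Filter Topology
open scoped RealInnerProductSpace Matrix ENNReal

noncomputable section

namespace OpWeighted

/-! ### Gaussian prior and white noise -/

section Gaussian

variable {H : Type*} [NormedAddCommGroup H] [InnerProductSpace ℝ H] [CompleteSpace H]
  [SecondCountableTopology H] [MeasurableSpace H] [BorelSpace H]

/-- `μ = N(m, Γ)`: the Gaussian measure `μ` on `H` has mean `m` and (centred) covariance
operator `Γ`. -/
structure IsGaussianWith (μ : Measure H) [IsGaussian μ] (m : H) (Γ : H →L[ℝ] H) : Prop where
  mean_eq : ∫ u, u ∂μ = m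
  covariance_eq : ∀ x y : H, covarianceBilin μ x y = ⟪Γ x, y⟫

/-- The covariance operators under consideration: self-adjoint, positive definite, trace class.
(For a positive operator the trace may be computed in any orthonormal basis.) -/
structure IsCovarianceOperator (Γ : H →L[ℝ] H) : Prop where
  isSelfAdjoint : IsSelfAdjoint Γ
  posDef : ∀ x : H, x ≠ 0 → 0 < ⟪Γ x, x⟫
  traceClass : ∀ e : HilbertBasis ℕ ℝ H, Summable fun i => ⟪Γ (e i), e i⟫

/-- `R` is the positive square root `Γ^{1/2}` of `Γ`. -/
structure IsSqrt (R Γ : H →L[ℝ] H) : Prop where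
  isPositive : R.IsPositive
  sq_eq : R ∘L R = Γ

/-- The centred variable `u ↦ u - m`, `m = ∫ u ∂μ`, as an element of `L²(μ; H)`. -/
def centred (μ : Measure H) [IsGaussian μ] : Lp H 2 μ :=
  MemLp.toLp (fun u : H => u - ∫ x, x ∂μ) ((IsGaussian.memLp_two_id (μ := μ)).sub (memLp_const _))

/-- The linear map `h ↦ ⟪h, u - m⟫` from `H` to `L²(μ)`. -/
def centredInner (μ : Measure H) [IsGaussian μ] : H →ₗ[ℝ] Lp ℝ 2 μ where
  toFun h := (innerSL ℝ h).compLp (centred μ)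
  map_add' h k := by rw [map_add, ContinuousLinearMap.add_compLp]
  map_smul' c h := by rw [map_smul, ContinuousLinearMap.smul_compLp, RingHom.id_apply]

/-- The white noise `Γ^{-1/2}(u - m)` attached to `μ = N(m, Γ)`, where `R = Γ^{1/2}`:
`whitened μ R h` is the random variable `⟪h, Γ^{-1/2}(u - m)⟫`. It is the continuous map
`H → L²(μ)` with `whitened μ R (R h) = ⟪h, u - m⟫`, extended from the dense range of `R` (on which
it is isometric since `∫ ⟪h, u - m⟫² dμ = ⟪Γ h, h⟫ = ‖R h‖²`). -/
def whitened (μ : Measure H) [IsGaussian μ] (R : H →L[ℝ] H) : H →L[ℝ] Lp ℝ 2 μ :=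
  (centredInner μ).extendOfNorm (R : H →ₗ[ℝ] H)

/-- The terms `zᵢ • K ψᵢ` of the expansion of `K z`, for a white noise `z = ∑ᵢ zᵢ ψᵢ` with
coordinates `zᵢ ∈ L²(P)`, as elements of `L²(P; H)`. -/
def noiseTerm {Ω : Type*} [MeasurableSpace Ω] (P : Measure Ω) (ψ : HilbertBasis ℕ ℝ H)
    (K : H →L[ℝ] H) (z : ℕ → Lp ℝ 2 P) (i : ℕ) : Lp H 2 P :=
  (ContinuousLinearMap.toSpanSingleton ℝ (K (ψ i))).compLp (z i)

/-- `K z = ∑ᵢ zᵢ • K ψᵢ`, for a white noise `z = ∑ᵢ zᵢ ψᵢ`; the sum is taken in `L²(P; H)`. -/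
def applyNoise {Ω : Type*} [MeasurableSpace Ω] (P : Measure Ω) (ψ : HilbertBasis ℕ ℝ H)
    (K : H →L[ℝ] H) (z : ℕ → Lp ℝ 2 P) : Lp H 2 P :=
  ∑' i, noiseTerm P ψ K z i

/-- The coordinates `⟪ψᵢ, Γ^{-1/2}(u - m)⟫` of the whitened prior variable. -/
def priorCoord (μ : Measure H) [IsGaussian μ] (R : H →L[ℝ] H) (ψ : HilbertBasis ℕ ℝ H) (i : ℕ) :
    Lp ℝ 2 μ :=
  whitened μ R (ψ i)

end Gaussian

/-- The law of the coordinates of `ξ ∼ N(0, I)`: independent standard normal variables. -/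
def stdNoise : Measure (ℕ → ℝ) :=
  Measure.infinitePi fun _ : ℕ => gaussianReal 0 1

/-- The coordinate `ξᵢ`. -/
def noiseCoord (i : ℕ) : Lp ℝ 2 stdNoise :=
  MemLp.toLp (fun ω : ℕ → ℝ => ω i)
    ((memLp_id_gaussianReal' (μ := 0) (v := 1) 2 (by norm_num)).comp_measurePreserving
      (measurePreserving_eval_infinitePi (fun _ : ℕ => gaussianReal 0 1) i))

/-! ### Forward model and posterior -/

section Model

variable {H : Type*} [NormedAddCommGroup H] [InnerProductSpace ℝ H]
  {X : Type*} [NormedAddCommGroup X] [NormedSpace ℝ X] {N : ℕ}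

/-- The standing assumptions on the forward operator `F : X → ℝᴺ`, where the Banach space `X` is
a subspace of `H` via the inclusion `ι`. -/
structure ForwardAssumption (ι : X →L[ℝ] H) (F : X → EuclideanSpace ℝ (Fin N)) : Prop where
  growth : ∀ ε > (0 : ℝ), ∃ K > (0 : ℝ), ∀ x : X, ‖F x‖ ≤ Real.exp (K + ε * ‖ι x‖ ^ 2)
  lipschitz : ∀ ε > (0 : ℝ), ∃ K > (0 : ℝ), ∀ x₁ x₂ : X, ‖ι x₁‖ < ε → ‖ι x₂‖ < ε →
    ‖F x₁ - F x₂‖ ≤ K * ‖ι x₁ - ι x₂‖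
  differentiable : ∀ x : X, ∃ J : X →L[ℝ] EuclideanSpace ℝ (Fin N),
    Tendsto (fun δ : X => ‖F (x + δ) - F x - J δ‖ / ‖ι δ‖) (𝓝[≠] 0) (𝓝 0)

/-- The data misfit `η(x; y) = ½ (F(x) - y)ᵀ Γ_obs⁻¹ (F(x) - y)`. -/
def misfit (F : X → EuclideanSpace ℝ (Fin N)) (Γobs : Matrix (Fin N) (Fin N) ℝ)
    (y : EuclideanSpace ℝ (Fin N)) (x : X) : ℝ :=
  (1 / 2 : ℝ) * ((F x - y).ofLp ⬝ᵥ (Γobs⁻¹ *ᵥ (F x - y).ofLp))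

/-- `g ∈ H` is the `H`-gradient at `x` of the function `η` on `X`. -/
def IsGradientAt (ι : X →L[ℝ] H) (η : X → ℝ) (x : X) (g : H) : Prop :=
  Tendsto (fun δ : X => |η (x + δ) - η x - ⟪g, ι δ⟫| / ‖ι δ‖) (𝓝[≠] 0) (𝓝 0)

open Classical in
/-- The `H`-gradient `∇η(x)` (with value `0` where there is none). -/
def gradientAt (ι : X →L[ℝ] H) (η : X → ℝ) (x : X) : H :=
  if h : ∃ g, IsGradientAt ι η x g then h.choose else 0

/-- The posterior `μ_y(du) ∝ exp(-η(u; y)) μ₀(du)`, a measure on `H`. The misfit is extended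
by `0` to the `μ₀`-null set outside `X`. -/
def posterior [MeasurableSpace H] (μ₀ : Measure H) (ι : X →L[ℝ] H)
    (F : X → EuclideanSpace ℝ (Fin N)) (Γobs : Matrix (Fin N) (Fin N) ℝ)
    (y : EuclideanSpace ℝ (Fin N)) : Measure H :=
  μ₀.tilted fun u => - Function.extend ι (misfit F Γobs y) 0 u

end Model

/-! ### Operator-weighted proposals and Metropolis--Hastings -/

section Proposal

variable {H : Type*} [NormedAddCommGroup H] [InnerProductSpace ℝ H] [CompleteSpace H]
  [SecondCountableTopology H] [MeasurableSpace H] [BorelSpace H]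
  {X : Type*} [NormedAddCommGroup X] [NormedSpace ℝ X]

/-- The deterministic part of the proposal,
`R A R⁻¹ (u - u_ref) + u_ref - R G R ∇η(u)`, where `R = Γ^{1/2}` and
`u_ref = m₀ + R vref`, `m₀` being the mean of `μ₀`. Since `R⁻¹ (u - u_ref) = R⁻¹ (u - m₀) - vref`, the
first term is `R A R⁻¹ (u - m₀) - R A vref`. It is defined for `μ₀`-almost every `u`. -/
def proposalMean (μ₀ : Measure H) [IsGaussian μ₀] (R A G : H →L[ℝ] H) (ψ : HilbertBasis ℕ ℝ H)
    (vref : H) (ι : X →L[ℝ] H) (η : X → ℝ) (u : H) : H :=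
  (applyNoise μ₀ ψ (R ∘L A) (priorCoord μ₀ R ψ) u - R (A vref))
    + ((∫ x, x ∂μ₀) + R vref)
    - R (G (R (Function.extend ι (gradientAt ι η) 0 u)))

/-- The proposal distribution `q(u, ·)`: the law of
`u' = R A R⁻¹ (u - u_ref) + u_ref - R G R ∇η(u) + R B ξ`, `ξ ∼ N(0, I)`, for fixed `u`. -/
def proposalLaw (μ₀ : Measure H) [IsGaussian μ₀] (R A B G : H →L[ℝ] H) (ψ : HilbertBasis ℕ ℝ H)
    (vref : H) (ι : X →L[ℝ] H) (η : X → ℝ) (u : H) : Measure H :=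
  stdNoise.map fun ω => proposalMean μ₀ R A G ψ vref ι η u
    + applyNoise stdNoise ψ (R ∘L B) noiseCoord ω

/-- `q` is a Markov kernel which realizes the proposal (defined up to `μ₀`-null sets of `u`). -/
structure IsProposalKernel (μ₀ : Measure H) [IsGaussian μ₀] (R A B G : H →L[ℝ] H)
    (ψ : HilbertBasis ℕ ℝ H) (vref : H) (ι : X →L[ℝ] H) (η : X → ℝ) (q : Kernel H H) : Prop where
  isMarkov : IsMarkovKernel q
  law_eq : ∀ᵐ u ∂μ₀, q u = proposalLaw μ₀ R A B G ψ vref ι η u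

/-- `ν(du, du') = q(u, du') μ(du)`. -/
def mhForward (μ : Measure H) (q : Kernel H H) : Measure (H × H) :=
  μ ⊗ₘ q

/-- `ν^⊥(du, du') = q(u', du) μ(du')`. -/
def mhBackward (μ : Measure H) (q : Kernel H H) : Measure (H × H) :=
  (μ ⊗ₘ q).map Prod.swap

end Proposal

end OpWeighted

end

namespace OpWeighted

/-! ### Equivalence of infinite product measures -/

section Product

variable {Ω : ℕ → Type*} [∀ i, MeasurableSpace (Ω i)]

/-! The proposal is compared with a reversible one. Choose `a'`, `b'` with `a'ᵢ² + b'ᵢ² = 1`; the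
autoregressive kernel `q'` that sends `u` to `m₀ + R A' R⁻¹ (u - m₀) + R B' ξ` is reversible for the
prior, so `μ₀ ⊗ₘ q'` is invariant under the swap (`map_swap_joint`). If `q(u, ·)` and `q'(u, ·)` are
equivalent for almost every `u`, then, posterior and prior being equivalent, `ν` is equivalent to
`μ₀ ⊗ₘ q'`, and by invariance so is its swap.

The coefficients come from `exists_reversible_coefficients`: `a'` differs from `a` in finitely many
places only, and `b = b' β` with `∑ (βᵢ² - 1)² < ∞`. For fixed `u`, the two proposal laws are then
images of white noise, one with coordinates `ξᵢ` and the other with `βᵢ ξᵢ + tᵢ`, under the same map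
(`map_noiseSeries_equiv`). The shift `t` is square summable because the means differ by `R S(u)`
with `S(u) ∈ H`, the coordinates of `S(u)` vanish where there is no noise, and `b'` is bounded below
elsewhere (`proposalLaw_equiv`). The two coordinate laws are products of normal distributions,
equivalent by Kakutani's criterion (`infinitePi_absolutelyContinuous`) and an explicit Hellinger
estimate.

Finally `∇η` must exist as an element of `H` and be measurable: the Lipschitz bound makes the
derivative continuous for the norm of `H`, and `X` is dense because it has full Gaussian measure. -/

theorem integral_finset_prod_infinitePi {𝕜 : Type*} [RCLike 𝕜] (Q : ∀ i, Measure (Ω i))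
    [∀ i, IsProbabilityMeasure (Q i)] {k : ∀ i, Ω i → 𝕜} (hk : ∀ i, Measurable (k i))
    (s : Finset ℕ) :
    ∫ ω, ∏ i ∈ s, k i (ω i) ∂(Measure.infinitePi Q) = ∏ i ∈ s, ∫ x, k i x ∂(Q i) := by
  have hind : iIndepFun (fun (i : s) (ω : ∀ i, Ω i) => ω i) (Measure.infinitePi Q) :=
    (iIndepFun_infinitePi (P := Q) (X := fun _ x => x) (fun _ => measurable_id)).precomp
      Subtype.val_injective
  have h := hind.integral_fun_prod_comp (f := fun i : s => k i)
    (fun i => (measurable_pi_apply _).aemeasurable)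
    (fun i => (hk i).aestronglyMeasurable)
  simp_rw [← Finset.prod_coe_sort s]
  rw [h]
  refine Finset.prod_congr rfl fun i _ => ?_
  rw [← (measurePreserving_eval_infinitePi Q (i : ℕ)).map_eq, integral_map
    (measurable_pi_apply _).aemeasurable (hk i).aestronglyMeasurable]

/-- Weierstrass' product inequality. It converts summable Hellinger defects `1 - rᵢ` into a Cauchy
estimate for products of square roots of densities. -/
theorem one_sub_sum_le_prod {ι : Type*} (s : Finset ι) {r : ι → ℝ} (h0 : ∀ i, 0 ≤ r i)
    (h1 : ∀ i, r i ≤ 1) : 1 - ∑ i ∈ s, (1 - r i) ≤ ∏ i ∈ s, r i := by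
  classical
  induction s using Finset.induction_on with
  | empty => simp
  | insert a s ha ih =>
    rw [Finset.sum_insert ha, Finset.prod_insert ha]
    have hp : ∏ i ∈ s, r i ≤ 1 := Finset.prod_le_one (fun i _ => h0 i) fun i _ => h1 i
    nlinarith [h0 a, h1 a]

/-- Kakutani's criterion, for densities `hᵢ²`. -/
theorem infinitePi_absolutelyContinuous {P Q : ∀ i, Measure (Ω i)}
    [∀ i, IsProbabilityMeasure (P i)] [∀ i, IsProbabilityMeasure (Q i)] {h : ∀ i, Ω i → ℝ}
    (hm : ∀ i, Measurable (h i)) (h0 : ∀ i x, 0 ≤ h i x)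
    (hP : ∀ i, P i = (Q i).withDensity fun x => ENNReal.ofReal (h i x ^ 2))
    (hs : Summable fun i => 1 - ∫ x, h i x ∂(Q i)) :
    Measure.infinitePi P ≪ Measure.infinitePi Q := by
  set M := Measure.infinitePi Q with hM
  have hsq (i : ℕ) : ∫ x, h i x ^ 2 ∂(Q i) = 1 := by
    have h1 : ∫⁻ x, ENNReal.ofReal (h i x ^ 2) ∂(Q i) = 1 := by
      rw [← setLIntegral_univ, ← withDensity_apply _ MeasurableSet.univ, ← hP, measure_univ]
    rw [integral_eq_lintegral_of_nonneg_ae (ae_of_all _ fun x => sq_nonneg _)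
      ((hm i).pow_const 2).aestronglyMeasurable, h1, ENNReal.toReal_one]
  have hsqi (i : ℕ) : Integrable (fun x => h i x ^ 2) (Q i) := integrable_of_integral_eq_one (hsq i)
  have hL2 (i : ℕ) : MemLp (h i) 2 (Q i) :=
    (memLp_two_iff_integrable_sq (hm i).aestronglyMeasurable).2 (hsqi i)
  have hint (i : ℕ) : Integrable (h i) (Q i) := (hL2 i).integrable (by norm_num)
  have hr0 (i : ℕ) : 0 ≤ ∫ x, h i x ∂(Q i) := integral_nonneg (h0 i)
  have hr1 (i : ℕ) : ∫ x, h i x ∂(Q i) ≤ 1 := by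
    have : ∫ x, h i x ∂(Q i) ≤ ∫ x, (1 / 2 + 1 / 2 * h i x ^ 2) ∂(Q i) :=
      integral_mono (hint i) ((integrable_const _).add ((hsqi i).const_mul _))
        fun x => by nlinarith [sq_nonneg (h i x - 1)]
    rw [integral_add (integrable_const _) ((hsqi i).const_mul _), integral_const_mul, hsq] at this
    simpa using this.trans (by norm_num)
  -- The square root of the density of the first `n` coordinates: a unit vector of `L²(M)`. These
  -- vectors converge, and the square of the limit is the required density.
  let F (n : ℕ) (ω : ∀ i, Ω i) : ℝ := ∏ i ∈ Finset.range n, h i (ω i)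
  have hFm (n : ℕ) : Measurable (F n) :=
    Finset.measurable_fun_prod _ fun i _ => (hm i).comp (measurable_pi_apply i)
  have hF1 (n : ℕ) : ∫ ω, F n ω ^ 2 ∂M = 1 := by
    simp only [F, ← Finset.prod_pow]
    rw [integral_finset_prod_infinitePi Q (k := fun i x => h i x ^ 2)
      (fun i => (hm i).pow_const 2)]
    simp [hsq]
  have hF2 (n : ℕ) : MemLp (F n) 2 M :=
    (memLp_two_iff_integrable_sq (hFm n).aestronglyMeasurable).2
      (integrable_of_integral_eq_one (hF1 n))
  let f (n : ℕ) : Lp ℝ 2 M := (hF2 n).toLp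
  have hfin (m n : ℕ) : ⟪f m, f n⟫ = ∫ ω, F m ω * F n ω ∂M := by
    rw [L2.inner_def]
    refine integral_congr_ae ?_
    filter_upwards [(hF2 m).coeFn_toLp, (hF2 n).coeFn_toLp] with ω h1 h2
    simp [f, h1, h2, mul_comm]
  have hnorm (n : ℕ) : ‖f n‖ ^ 2 = 1 := by
    rw [← real_inner_self_eq_norm_sq, hfin, ← hF1 n]
    simp only [sq]
  -- The factors common to `F n` and `F m` appear squared and integrate to 1; only the Hellinger
  -- affinities for `n ≤ i < m` survive.
  have hcross {n m : ℕ} (hnm : n ≤ m) :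
      ⟪f n, f m⟫ = ∏ i ∈ Finset.Ico n m, ∫ x, h i x ∂(Q i) := by
    let k (i : ℕ) (x : Ω i) : ℝ := if i < n then h i x ^ 2 else h i x
    have hk (i : ℕ) : Measurable (k i) := by
      by_cases hi : i < n
      · simpa only [k, hi, if_true] using (hm i).pow_const 2
      · simpa only [k, hi, if_false] using hm i
    have h1 : ∀ ω, F n ω * F m ω = ∏ i ∈ Finset.range m, k i (ω i) := fun ω => by
      simp only [F]
      rw [← Finset.prod_range_mul_prod_Ico _ hnm, ← Finset.prod_range_mul_prod_Ico _ hnm,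
        ← mul_assoc, ← Finset.prod_mul_distrib]
      congr 1
      · refine Finset.prod_congr rfl fun i hi => ?_
        simp [k, Finset.mem_range.1 hi, sq]
      · refine Finset.prod_congr rfl fun i hi => ?_
        simp [k, (Finset.mem_Ico.1 hi).1]
    rw [hfin]
    simp_rw [h1]
    rw [integral_finset_prod_infinitePi Q hk, ← Finset.prod_range_mul_prod_Ico _ hnm,
      Finset.prod_eq_one, one_mul]
    · refine Finset.prod_congr rfl fun i hi => ?_
      simp only [k, not_lt.2 (Finset.mem_Ico.1 hi).1, if_false]
    · intro i hi
      simp [k, Finset.mem_range.1 hi, hsq]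
  have hdist {n m : ℕ} (hnm : n ≤ m) :
      ‖f m - f n‖ ^ 2 ≤ 2 * ∑ i ∈ Finset.Ico n m, (1 - ∫ x, h i x ∂(Q i)) := by
    rw [norm_sub_sq_real, hnorm, hnorm, real_inner_comm, hcross hnm]
    linarith [one_sub_sum_le_prod (Finset.Ico n m) hr0 hr1]
  have hcauchy : CauchySeq f := by
    rw [Metric.cauchySeq_iff']
    intro ε hε
    obtain ⟨N, hN⟩ := Metric.cauchySeq_iff'.1 hs.hasSum.tendsto_sum_nat.cauchySeq (ε ^ 2 / 2)
      (by positivity)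
    refine ⟨N, fun n hn => ?_⟩
    have h1 := hN n hn
    rw [Real.dist_eq, ← Finset.sum_Ico_eq_sub _ hn] at h1
    rw [dist_eq_norm]
    refine lt_of_pow_lt_pow_left₀ 2 hε.le ?_
    linarith [hdist hn, le_abs_self (∑ i ∈ Finset.Ico N n, (1 - ∫ x, h i x ∂(Q i)))]
  obtain ⟨g, hg⟩ := cauchySeq_tendsto_of_complete hcauchy
  have hgi : Integrable (fun ω => g ω ^ 2) M := (Lp.memLp g).integrable_sq
  have hset (S : Set (∀ i, Ω i)) : Tendsto (fun n => ∫ ω in S, F n ω ^ 2 ∂M) atTop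
      (𝓝 (∫ ω in S, g ω ^ 2 ∂M)) := by
    have hn (u : Lp ℝ 2 M) : ‖LpToLpRestrictCLM (∀ i, Ω i) ℝ ℝ M 2 S u‖ ^ 2
        = ∫ ω in S, u ω ^ 2 ∂M := by
      rw [← real_inner_self_eq_norm_sq, L2.inner_def]
      refine integral_congr_ae ?_
      filter_upwards [LpToLpRestrictCLM_coeFn ℝ S u] with ω h1
      simp [h1, sq]
    have hF' (n : ℕ) : ∫ ω in S, F n ω ^ 2 ∂M = ∫ ω in S, f n ω ^ 2 ∂M := by
      refine integral_congr_ae (ae_restrict_of_ae ?_)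
      filter_upwards [(hF2 n).coeFn_toLp] with ω h1
      simp only [f, h1]
    simp_rw [hF', ← hn]
    exact ((((LpToLpRestrictCLM (∀ i, Ω i) ℝ ℝ M 2 S).continuous.norm).pow 2).tendsto g).comp hg
  have hbox (s : Finset ℕ) (t : ∀ i, Set (Ω i)) (ht : ∀ i, MeasurableSet (t i)) :
      ∫ ω in Set.pi s t, g ω ^ 2 ∂M = ∏ i ∈ s, ∫ x in t i, h i x ^ 2 ∂(Q i) := by
    -- Once `n` exceeds all indices in `s`, the integral of `F n ^ 2` over the box no longer depends
    -- on `n`.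
    refine tendsto_nhds_unique (hset _) (tendsto_const_nhds.congr' ?_)
    obtain ⟨N, hN⟩ := s.exists_nat_subset_range
    filter_upwards [eventually_ge_atTop N] with n hn
    classical
    let k (i : ℕ) : Ω i → ℝ := Set.indicator (if i ∈ s then t i else Set.univ) fun x => h i x ^ 2
    have htm (i : ℕ) : MeasurableSet (if i ∈ s then t i else Set.univ) := by
      split_ifs
      exacts [ht i, MeasurableSet.univ]
    have hk (i : ℕ) : Measurable (k i) := ((hm i).pow_const 2).indicator (htm i)
    have hsn : s ⊆ Finset.range n := hN.trans (Finset.range_mono hn)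
    have h1 : ∀ ω, Set.indicator (Set.pi (s : Set ℕ) t) (fun ω => F n ω ^ 2) ω
        = ∏ i ∈ Finset.range n, k i (ω i) := fun ω => by
      by_cases hω : ω ∈ Set.pi (s : Set ℕ) t
      · rw [Set.indicator_of_mem hω, ← Finset.prod_pow]
        refine Finset.prod_congr rfl fun i _ => ?_
        simp only [k]
        rw [Set.indicator_of_mem]
        split_ifs with hi
        exacts [hω i hi, Set.mem_univ _]
      · rw [Set.indicator_of_notMem hω]
        simp only [Set.mem_pi, not_forall] at hω
        obtain ⟨i, hi, hit⟩ := hω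
        refine (Finset.prod_eq_zero (hsn hi) ?_).symm
        simp only [k]
        rw [Set.indicator_of_notMem]
        rw [if_pos (Finset.mem_coe.1 hi)]
        exact hit
    rw [← integral_indicator (MeasurableSet.pi s.countable_toSet fun i _ => ht i)]
    simp_rw [h1]
    rw [integral_finset_prod_infinitePi Q hk, ← Finset.prod_subset hsn]
    · refine Finset.prod_congr rfl fun i hi => ?_
      simp only [k, hi, if_true]
      rw [integral_indicator (ht i)]
    · intro i _ hi
      simp [k, hi, hsq]
  have hlast : M.withDensity (fun ω => ENNReal.ofReal (g ω ^ 2)) = Measure.infinitePi P := by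
    refine Measure.eq_infinitePi _ fun s t ht => ?_
    rw [withDensity_apply _ (MeasurableSet.pi s.countable_toSet fun i _ => ht i),
      ← ofReal_integral_eq_lintegral_ofReal hgi.integrableOn (ae_of_all _ fun _ => sq_nonneg _),
      hbox s t ht, ENNReal.ofReal_prod_of_nonneg fun i _ => integral_nonneg fun x => sq_nonneg _]
    refine Finset.prod_congr rfl fun i _ => ?_
    rw [hP, withDensity_apply _ (ht i),
      ← ofReal_integral_eq_lintegral_ofReal (hsqi i).integrableOn (ae_of_all _ fun _ => sq_nonneg _)]
  rw [← hlast]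
  exact withDensity_absolutelyContinuous _ _

end Product

/-! ### Equivalence of infinite products of normal distributions -/

section GaussianProduct

open scoped NNReal

theorem gaussianReal_eq_withDensity (m₁ m₂ : ℝ) {v₁ v₂ : ℝ≥0} (h₁ : v₁ ≠ 0) (h₂ : v₂ ≠ 0) :
    gaussianReal m₁ v₁ = (gaussianReal m₂ v₂).withDensity fun x =>
      ENNReal.ofReal (√(gaussianPDFReal m₁ v₁ x / gaussianPDFReal m₂ v₂ x) ^ 2) := by
  have hm : Measurable fun x => ENNReal.ofReal
      (√(gaussianPDFReal m₁ v₁ x / gaussianPDFReal m₂ v₂ x) ^ 2) :=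
    ((((measurable_gaussianPDFReal m₁ v₁).div
      (measurable_gaussianPDFReal m₂ v₂)).sqrt).pow_const 2).ennreal_ofReal
  rw [gaussianReal_of_var_ne_zero _ h₁, gaussianReal_of_var_ne_zero _ h₂,
    ← withDensity_mul _ (measurable_gaussianPDF m₂ v₂) hm]
  congr 1
  ext x
  have hp := gaussianPDFReal_pos m₂ v₂ x h₂
  rw [Pi.mul_apply, gaussianPDF, gaussianPDF, ← ENNReal.ofReal_mul hp.le,
    Real.sq_sqrt (div_nonneg (gaussianPDFReal_nonneg _ _ _) hp.le), mul_div_cancel₀ _ hp.ne']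

/-- As a Lebesgue integral the affinity is symmetric in the two laws, so one estimate serves both
directions of absolute continuity. -/
theorem integral_sqrt_gaussianPDFReal_div (m₁ m₂ : ℝ) {v₁ v₂ : ℝ≥0} (h₂ : v₂ ≠ 0) :
    ∫ x, √(gaussianPDFReal m₁ v₁ x / gaussianPDFReal m₂ v₂ x) ∂(gaussianReal m₂ v₂) =
      ∫ x, √(gaussianPDFReal m₁ v₁ x * gaussianPDFReal m₂ v₂ x) := by
  rw [integral_gaussianReal_eq_integral_smul h₂]
  refine integral_congr_ae (ae_of_all _ fun x => ?_)
  have hp := gaussianPDFReal_pos m₂ v₂ x h₂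
  have h1 := gaussianPDFReal_nonneg m₁ v₁ x
  simp only [smul_eq_mul]
  rw [Real.sqrt_div h1, Real.sqrt_mul h1]
  nth_rewrite 1 [← Real.mul_self_sqrt hp.le]
  have : √(gaussianPDFReal m₂ v₂ x) ≠ 0 := (Real.sqrt_pos.2 hp).ne'
  field_simp

/-- Completing the square shows that the integrand is a constant times the normal density of mean `t
/ (1 + v)` and variance `2v / (1 + v)`. -/
theorem integral_sqrt_gaussianPDFReal_mul_std (t : ℝ) {v : ℝ≥0} (hv : v ≠ 0) :
    ∫ x, √(gaussianPDFReal t v x * gaussianPDFReal 0 1 x) =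
      √(2 * √v / (1 + v) * Real.exp (-t ^ 2 / (2 * (1 + v)))) := by
  have hv0 : (0 : ℝ) < v := by positivity
  set w : ℝ≥0 := 2 * v / (1 + v) with hw
  have hwr : (w : ℝ) = 2 * v / (1 + v) := by simp [hw]
  have hw0 : w ≠ 0 := by positivity
  have key (x : ℝ) : √(gaussianPDFReal t v x * gaussianPDFReal 0 1 x) =
      √(2 * √v / (1 + v) * Real.exp (-t ^ 2 / (2 * (1 + v)))) *
        gaussianPDFReal (t / (1 + v)) w x := by
    rw [← Real.sqrt_sq (gaussianPDFReal_nonneg (t / (1 + v)) w x), ← Real.sqrt_mul (by positivity)]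
    congr 1
    simp only [gaussianPDFReal, NNReal.coe_one, mul_one, hwr, mul_pow, inv_pow]
    have h1 : √(2 * Real.pi * v) = √(2 * Real.pi) * √v := Real.sqrt_mul (by positivity) _
    have h2 : √(2 * Real.pi * (2 * v / (1 + v))) ^ 2 = 2 * Real.pi * (2 * v / (1 + v)) :=
      Real.sq_sqrt (by positivity)
    have h3 : √(2 * Real.pi) * √(2 * Real.pi) = 2 * Real.pi := Real.mul_self_sqrt (by positivity)
    have h4 : √(v : ℝ) * √v = v := Real.mul_self_sqrt hv0.le
    have h5 : Real.exp (-(x - t) ^ 2 / (2 * v)) * Real.exp (-(x - 0) ^ 2 / 2) =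
        Real.exp (-t ^ 2 / (2 * (1 + v))) *
          Real.exp (-(x - t / (1 + v)) ^ 2 / (2 * (2 * v / (1 + v)))) ^ 2 := by
      rw [← Real.exp_add, ← Real.exp_nat_mul, ← Real.exp_add]
      congr 1
      push_cast
      field_simp
      ring
    have h6 : (√(2 * Real.pi * v))⁻¹ * (√(2 * Real.pi))⁻¹ =
        2 * √v / (1 + v) * (2 * Real.pi * (2 * v / (1 + v)))⁻¹ := by
      rw [h1, ← mul_inv, mul_right_comm, h3]
      have : √(v : ℝ) ≠ 0 := (Real.sqrt_pos.2 hv0).ne'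
      have := Real.pi_pos.ne'
      field_simp
      nlinarith
    rw [h2]
    linear_combination (Real.exp (-(x - t) ^ 2 / (2 * v)) * Real.exp (-(x - 0) ^ 2 / 2)) * h6 +
      (2 * √v / (1 + v) * (2 * Real.pi * (2 * v / (1 + v)))⁻¹) * h5
  simp_rw [key]
  rw [integral_const_mul, integral_gaussianPDFReal_eq_one _ hw0, mul_one]

/-- With `s = √v`, the affinity is `√(k E)`, where `1 - k = (s - 1)² / (1 + s²) ≤ (s² - 1)²` and `1
- E ≤ t²`. Since `k E ≤ 1`, the outer root only increases the value and may be dropped. -/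
theorem one_sub_integral_sqrt_gaussianPDFReal_le (t : ℝ) {v : ℝ≥0} (hv : v ≠ 0) :
    1 - ∫ x, √(gaussianPDFReal t v x * gaussianPDFReal 0 1 x) ≤ (v - 1 : ℝ) ^ 2 + t ^ 2 ∧
      0 ≤ 1 - ∫ x, √(gaussianPDFReal t v x * gaussianPDFReal 0 1 x) := by
  have hv0 : (0 : ℝ) < v := by positivity
  rw [integral_sqrt_gaussianPDFReal_mul_std t hv]
  set s := √(v : ℝ) with hs
  have hs0 : 0 < s := Real.sqrt_pos.2 hv0
  have hsv : (v : ℝ) = s ^ 2 := (Real.sq_sqrt hv0.le).symm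
  rw [hsv]
  set E := Real.exp (-t ^ 2 / (2 * (1 + s ^ 2))) with hE
  have hE1 : E ≤ 1 := Real.exp_le_one_iff.2
    (div_nonpos_of_nonpos_of_nonneg (by nlinarith [sq_nonneg t]) (by positivity))
  have hE2 : 1 - t ^ 2 ≤ E := by
    have h1 := Real.add_one_le_exp (-t ^ 2 / (2 * (1 + s ^ 2)))
    have h2 : t ^ 2 / (2 * (1 + s ^ 2)) ≤ t ^ 2 := div_le_self (sq_nonneg t) (by nlinarith)
    rw [neg_div] at h1
    rw [hE, neg_div]
    linarith
  have hE0 : 0 < E := Real.exp_pos _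
  set k := 2 * s / (1 + s ^ 2) with hk
  have hk0 : 0 ≤ k := by positivity
  have hk1 : 1 - k = (s - 1) ^ 2 / (1 + s ^ 2) := by
    rw [hk]; field_simp; ring
  have hk2 : k ≤ 1 := by
    have : 0 ≤ (s - 1) ^ 2 / (1 + s ^ 2) := by positivity
    linarith
  have hk3 : 1 - k ≤ (s ^ 2 - 1) ^ 2 := by
    rw [hk1]
    refine (div_le_self (sq_nonneg _) (by nlinarith)).trans ?_
    have : (s ^ 2 - 1) ^ 2 = (s - 1) ^ 2 * (s + 1) ^ 2 := by ring
    rw [this]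
    exact le_mul_of_one_le_right (sq_nonneg _) (by nlinarith)
  have hkE : k * E ≤ 1 := mul_le_one₀ hk2 hE0.le hE1
  have h1 : √(k * E) ≤ 1 := Real.sqrt_le_one.2 hkE
  have h2 : k * E ≤ √(k * E) := Real.le_sqrt_of_sq_le (by nlinarith [mul_nonneg hk0 hE0.le])
  refine ⟨?_, by linarith⟩
  nlinarith

theorem infinitePi_gaussianReal_equiv_stdNoise {t : ℕ → ℝ} {v : ℕ → ℝ≥0} (hv : ∀ i, v i ≠ 0)
    (hsv : Summable fun i => (v i - 1 : ℝ) ^ 2) (hst : Summable fun i => t i ^ 2) :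
    Measure.infinitePi (fun i => gaussianReal (t i) (v i)) ≪ stdNoise ∧
      stdNoise ≪ Measure.infinitePi (fun i => gaussianReal (t i) (v i)) := by
  have hs : Summable fun i =>
      1 - ∫ x, √(gaussianPDFReal (t i) (v i) x * gaussianPDFReal 0 1 x) :=
    Summable.of_nonneg_of_le (fun i => (one_sub_integral_sqrt_gaussianPDFReal_le (t i) (hv i)).2)
      (fun i => (one_sub_integral_sqrt_gaussianPDFReal_le (t i) (hv i)).1) (hsv.add hst)
  refine ⟨infinitePi_absolutelyContinuous (h := fun i x =>
      √(gaussianPDFReal (t i) (v i) x / gaussianPDFReal 0 1 x)) (fun i => ?_)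
      (fun i x => Real.sqrt_nonneg _)
      (fun i => gaussianReal_eq_withDensity _ _ (hv i) one_ne_zero) ?_,
    infinitePi_absolutelyContinuous (h := fun i x =>
      √(gaussianPDFReal 0 1 x / gaussianPDFReal (t i) (v i) x)) (fun i => ?_)
      (fun i x => Real.sqrt_nonneg _)
      (fun i => gaussianReal_eq_withDensity _ _ one_ne_zero (hv i)) ?_⟩
  · exact ((measurable_gaussianPDFReal _ _).div (measurable_gaussianPDFReal _ _)).sqrt
  · simpa only [integral_sqrt_gaussianPDFReal_div _ _ one_ne_zero] using hs
  · exact ((measurable_gaussianPDFReal _ _).div (measurable_gaussianPDFReal _ _)).sqrt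
  · simpa only [integral_sqrt_gaussianPDFReal_div _ _ (hv _), mul_comm] using hs

theorem stdNoise_map_affine (β t : ℕ → ℝ) :
    stdNoise.map (fun ω i => β i * ω i + t i) =
      Measure.infinitePi fun i => gaussianReal (t i) (β i ^ 2).toNNReal := by
  rw [stdNoise, Measure.infinitePi_map_pi (fun _ => gaussianReal 0 1)
    (f := fun i x => β i * x + t i) fun i => by fun_prop]
  congr 1
  ext1 i
  have h : (fun x : ℝ => β i * x + t i) = (fun x => x + t i) ∘ fun x => β i * x := rfl
  rw [h, ← Measure.map_map (by fun_prop) (by fun_prop), gaussianReal_map_const_mul,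
    gaussianReal_map_add_const]
  congr 1
  · simp
  · ext; simp [Real.coe_toNNReal _ (sq_nonneg (β i))]

/-- The image of standard white noise under a diagonal affine perturbation of the identity. -/
theorem stdNoise_map_affine_equiv {β t : ℕ → ℝ} (hβ : ∀ i, β i ≠ 0)
    (hsβ : Summable fun i => (β i ^ 2 - 1) ^ 2) (hst : Summable fun i => t i ^ 2) :
    stdNoise.map (fun ω i => β i * ω i + t i) ≪ stdNoise ∧
      stdNoise ≪ stdNoise.map (fun ω i => β i * ω i + t i) := by
  rw [stdNoise_map_affine]
  refine infinitePi_gaussianReal_equiv_stdNoise (fun i => ?_) ?_ hst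
  · have := hβ i
    exact (Real.toNNReal_pos.2 (by positivity)).ne'
  · simpa only [Real.coe_toNNReal _ (sq_nonneg (β _))] using hsβ

end GaussianProduct

/-! ### Series of orthonormal random variables with coefficients in a Hilbert space -/

section Series

variable {H : Type*} [NormedAddCommGroup H] [InnerProductSpace ℝ H]
  {Ω : Type*} [MeasurableSpace Ω] {P : Measure Ω}

/-- The random vector `zᵢ • κᵢ`, as an element of `L²(P; H)`. -/
noncomputable def smulNoise (P : Measure Ω) (κ : ℕ → H) (z : ℕ → Lp ℝ 2 P) (i : ℕ) : Lp H 2 P :=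
  (ContinuousLinearMap.toSpanSingleton ℝ (κ i)).compLp (z i)

theorem coeFn_smulNoise (κ : ℕ → H) (z : ℕ → Lp ℝ 2 P) (i : ℕ) :
    smulNoise P κ z i =ᵐ[P] fun ω => z i ω • κ i := by
  simpa [smulNoise] using!
    (ContinuousLinearMap.toSpanSingleton ℝ (κ i)).coeFn_compLp' (z i)

theorem inner_smulNoise (κ : ℕ → H) (z : ℕ → Lp ℝ 2 P) (i j : ℕ) :
    ⟪smulNoise P κ z i, smulNoise P κ z j⟫ = ⟪κ i, κ j⟫ * ⟪z i, z j⟫ := by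
  rw [L2.inner_def, L2.inner_def, ← integral_const_mul]
  refine integral_congr_ae ?_
  filter_upwards [coeFn_smulNoise κ z i, coeFn_smulNoise κ z j] with ω h1 h2
  rw [h1, h2, real_inner_smul_left, real_inner_smul_right]
  simp
  ring

/-- The terms are orthogonal in `L²(P; H)` because the `zᵢ` are, whatever the position of the `κᵢ`;
Pythagoras then gives the Cauchy criterion. -/
theorem summable_smulNoise [CompleteSpace H] {κ : ℕ → H} {z : ℕ → Lp ℝ 2 P} (hz : Orthonormal ℝ z)
    (hκ : Summable fun i => ‖κ i‖ ^ 2) : Summable (smulNoise P κ z) := by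
  have hsum (t : Finset ℕ) : ‖∑ i ∈ t, smulNoise P κ z i‖ ^ 2 = ∑ i ∈ t, ‖κ i‖ ^ 2 := by
    rw [← real_inner_self_eq_norm_sq, sum_inner]
    refine Finset.sum_congr rfl fun i hi => ?_
    rw [inner_sum, Finset.sum_eq_single i, inner_smulNoise, real_inner_self_eq_norm_sq,
      real_inner_self_eq_norm_sq, hz.1 i]
    · simp
    · intro j _ hj
      rw [inner_smulNoise, hz.2 hj.symm, mul_zero]
    · exact fun h => (h hi).elim
  rw [summable_iff_vanishing_norm] at hκ ⊢
  intro ε hε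
  obtain ⟨s, hs⟩ := hκ (ε ^ 2) (by positivity)
  refine ⟨s, fun t ht => lt_of_pow_lt_pow_left₀ 2 hε.le ?_⟩
  rw [hsum]
  exact (le_abs_self _).trans_lt (hs t ht)

/-- Along a subsequence of any given sequence, the partial sums converge almost surely. -/
theorem exists_subseq_tendsto_smulNoise {κ : ℕ → H} {z : ℕ → Lp ℝ 2 P}
    (h : Summable (smulNoise P κ z)) {ns : ℕ → ℕ} (hns : Tendsto ns atTop atTop) :
    ∃ ms : ℕ → ℕ, StrictMono ms ∧ ∀ᵐ ω ∂P, Tendsto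
      (fun k => ∑ i ∈ Finset.range (ns (ms k)), z i ω • κ i) atTop
      (𝓝 ((∑' i, smulNoise P κ z i : Lp H 2 P) ω)) := by
  have h1 := h.hasSum.tendsto_sum_nat.comp hns
  obtain ⟨ms, hms, hms'⟩ := (tendstoInMeasure_of_tendsto_Lp h1).exists_seq_tendsto_ae
  refine ⟨ms, hms, ?_⟩
  have h2 : ∀ᵐ ω ∂P, ∀ i, smulNoise P κ z i ω = z i ω • κ i :=
    ae_all_iff.2 fun i => coeFn_smulNoise κ z i
  have h3 : ∀ᵐ ω ∂P, ∀ n, (∑ i ∈ Finset.range n, smulNoise P κ z i : Lp H 2 P) ω =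
      ∑ i ∈ Finset.range n, smulNoise P κ z i ω :=
    ae_all_iff.2 fun n => by
      filter_upwards [Lp.coeFn_finsetSum (Finset.range n) (smulNoise P κ z)] with ω hω
      rw [hω]
      simp
  filter_upwards [hms', h2, h3] with ω hω h2 h3
  simpa only [Function.comp_apply, h3, h2] using hω

theorem hasSum_inner_smulNoise {κ : ℕ → H} {z : ℕ → Lp ℝ 2 P}
    (h : Summable (smulNoise P κ z)) (k : H) :
    HasSum (fun i => ⟪k, κ i⟫ • z i) ((innerSL ℝ k).compLp (∑' i, smulNoise P κ z i)) := by
  have h1 := h.hasSum.mapL ((innerSL ℝ k).compLpL 2 P)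
  convert! h1 using 1
  ext1 i
  refine Lp.ext ?_
  filter_upwards [Lp.coeFn_smul ⟪k, κ i⟫ (z i), coeFn_smulNoise κ z i,
    ContinuousLinearMap.coeFn_compLpL (innerSL ℝ k) (smulNoise P κ z i)] with ω h2 h3 h4
  rw [h2, h4, h3]
  simp [mul_comm]

/-- The characteristic function at `1` depends continuously on the random variable. -/
theorem continuous_integral_exp [IsProbabilityMeasure P] :
    Continuous fun f : Lp ℝ 2 P => ∫ ω, Complex.exp (f ω * Complex.I) ∂P := by
  rw [continuous_iff_seqContinuous]
  intro f g hfg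
  -- `L²` convergence gives almost sure convergence only along subsequences; that suffices, and the
  -- constant 1 dominates.
  refine tendsto_of_subseq_tendsto fun ns hns => ?_
  obtain ⟨ms, hms, hms'⟩ := (tendstoInMeasure_of_tendsto_Lp (hfg.comp hns)).exists_seq_tendsto_ae
  refine ⟨ms, ?_⟩
  refine tendsto_integral_of_dominated_convergence (fun _ => (1 : ℝ)) (fun n => ?_)
    (integrable_const _) (fun n => ae_of_all _ fun ω => ?_) ?_
  · have := Lp.aestronglyMeasurable (f (ns (ms n)))
    fun_prop
  · rw [Complex.norm_exp_ofReal_mul_I]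
  · filter_upwards [hms'] with ω hω
    exact (Complex.continuous_exp.tendsto _).comp
      (((Complex.continuous_ofReal.tendsto _).comp hω).mul_const _)

end Series

/-! ### The coordinates of standard white noise -/

section StdNoise

instance : IsProbabilityMeasure stdNoise := by
  unfold stdNoise
  infer_instance

theorem coeFn_noiseCoord : ∀ᵐ ω ∂stdNoise, ∀ i, noiseCoord i ω = ω i :=
  ae_all_iff.2 fun _ => MemLp.coeFn_toLp _

theorem orthonormal_noiseCoord : Orthonormal ℝ noiseCoord := by
  have hin (i j : ℕ) : ⟪noiseCoord i, noiseCoord j⟫ = ∫ ω, ω i * ω j ∂stdNoise := by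
    rw [L2.inner_def]
    refine integral_congr_ae ?_
    filter_upwards [coeFn_noiseCoord] with ω h
    simp [h, mul_comm]
  rw [orthonormal_iff_ite]
  intro i j
  rw [hin]
  by_cases hij : i = j
  · subst hij
    have h1 := integral_finset_prod_infinitePi (fun _ : ℕ => gaussianReal 0 1)
      (k := fun _ x => x * x) (fun _ => by fun_prop) {i}
    have h2 : ∫ x : ℝ, x * x ∂(gaussianReal 0 1) = 1 := by
      have := variance_of_integral_eq_zero (μ := gaussianReal 0 1) (X := fun x => x)
        (by fun_prop) (by simp)
      rw [variance_fun_id_gaussianReal] at this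
      simpa [sq] using this.symm
    simpa [h2] using! h1
  · have h1 := integral_finset_prod_infinitePi (fun _ : ℕ => gaussianReal 0 1)
      (k := fun _ x => x) (fun _ => measurable_id) {i, j}
    simpa [hij] using! h1

/-- Independence factors the finite sums; `continuous_integral_exp` passes to the limit. -/
theorem integral_exp_hasSum_noiseCoord {c : ℕ → ℝ} {f : Lp ℝ 2 stdNoise}
    (hf : HasSum (fun i => c i • noiseCoord i) f) (hc : Summable fun i => c i ^ 2) :
    ∫ ω, Complex.exp (f ω * Complex.I) ∂stdNoise =
      Complex.exp (-((∑' i, c i ^ 2 : ℝ) : ℂ) / 2) := by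
  have h1 : Tendsto (fun s : Finset ℕ => ∫ ω,
      Complex.exp ((∑ i ∈ s, c i • noiseCoord i : Lp ℝ 2 stdNoise) ω * Complex.I) ∂stdNoise) atTop
      (𝓝 (∫ ω, Complex.exp (f ω * Complex.I) ∂stdNoise)) :=
    (continuous_integral_exp.tendsto f).comp hf
  have h2 (s : Finset ℕ) : ∫ ω,
      Complex.exp ((∑ i ∈ s, c i • noiseCoord i : Lp ℝ 2 stdNoise) ω * Complex.I) ∂stdNoise =
        Complex.exp (-((∑ i ∈ s, c i ^ 2 : ℝ) : ℂ) / 2) := by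
    have h3 := integral_finset_prod_infinitePi (fun _ : ℕ => gaussianReal 0 1)
      (k := fun i x => Complex.exp (c i * x * Complex.I)) (fun i => by fun_prop) s
    have h4 (i : ℕ) : ∫ x : ℝ, Complex.exp (c i * x * Complex.I) ∂(gaussianReal 0 1) =
        Complex.exp (-(c i : ℂ) ^ 2 / 2) := by
      have := charFun_gaussianReal (μ := 0) (v := 1) (c i)
      rw [charFun_apply_real] at this
      rw [this]
      congr 1
      simp
      ring
    simp_rw [h4, ← Complex.exp_sum] at h3
    convert! h3 using 1
    · refine integral_congr_ae ?_
      have h5 : ∀ᵐ ω ∂stdNoise, ∀ i, (c i • noiseCoord i : Lp ℝ 2 stdNoise) ω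
          = c i • noiseCoord i ω := ae_all_iff.2 fun i => Lp.coeFn_smul _ _
      filter_upwards [coeFn_noiseCoord, h5,
        Lp.coeFn_finsetSum s fun i => c i • noiseCoord i] with ω h6 h7 h8
      rw [h8, ← Finset.sum_mul]
      simp [h7, h6]
    · congr 1
      push_cast
      rw [← Finset.sum_div, ← Finset.sum_neg_distrib]
  simp_rw [h2] at h1
  refine tendsto_nhds_unique h1 ?_
  exact (Complex.continuous_exp.tendsto _).comp
    ((((Complex.continuous_ofReal.tendsto _).comp hc.hasSum).neg).div_const _)

theorem integral_exp_noiseSeries {H : Type*} [NormedAddCommGroup H] [InnerProductSpace ℝ H]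
    {e : ℕ → H} {z : H}
    (h : Summable (smulNoise stdNoise e noiseCoord)) (hz : Summable fun i => ⟪z, e i⟫ ^ 2) :
    ∫ ω, Complex.exp (⟪z, (∑' i, smulNoise stdNoise e noiseCoord i : Lp H 2 stdNoise) ω⟫ *
      Complex.I) ∂stdNoise = Complex.exp (-((∑' i, ⟪z, e i⟫ ^ 2 : ℝ) : ℂ) / 2) := by
  rw [← integral_exp_hasSum_noiseCoord (hasSum_inner_smulNoise h z) hz]
  refine integral_congr_ae ?_
  filter_upwards [(innerSL ℝ z).coeFn_compLp (∑' i, smulNoise stdNoise e noiseCoord i)] with ω hω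
  rw [hω, innerSL_apply_apply]

end StdNoise

/-! ### The whitened prior -/

section Whitened

variable {H : Type*} [NormedAddCommGroup H] [InnerProductSpace ℝ H]
  {R Γ : H →L[ℝ] H}

theorem IsSqrt.inner_eq (hR : IsSqrt R Γ) (x y : H) : ⟪Γ x, y⟫ = ⟪R x, R y⟫ := by
  rw [← hR.sq_eq]
  exact hR.isPositive.isSymmetric (R x) y

theorem IsSqrt.norm_sq_eq (hR : IsSqrt R Γ) (x : H) : ‖R x‖ ^ 2 = ⟪Γ x, x⟫ := by
  rw [hR.inner_eq, real_inner_self_eq_norm_sq]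

variable [CompleteSpace H]

theorem dense_of_orthogonal_eq_zero {K : Submodule ℝ H}
    (h : ∀ v : H, (∀ w ∈ K, ⟪w, v⟫ = 0) → v = 0) : Dense (K : Set H) := by
  rw [Submodule.dense_iff_topologicalClosure_eq_top, Submodule.topologicalClosure_eq_top_iff,
    Submodule.eq_bot_iff]
  exact fun v hv => h v fun w hw => Submodule.inner_right_of_mem_orthogonal hw hv

theorem IsSqrt.denseRange (hΓ : IsCovarianceOperator Γ) (hR : IsSqrt R Γ) :
    DenseRange (R : H →ₗ[ℝ] H) := by
  have h : Dense ((LinearMap.range (R : H →ₗ[ℝ] H) : Submodule ℝ H) : Set H) := by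
    refine dense_of_orthogonal_eq_zero fun v hv => ?_
    by_contra hne
    have h1 : ⟪R (R v), v⟫ = 0 := hv _ ⟨R v, rfl⟩
    have h2 := hΓ.posDef v hne
    rw [← hR.sq_eq] at h2
    exact h2.ne' h1
  simpa [DenseRange] using! h

theorem summable_norm_sq_sqrt (hΓ : IsCovarianceOperator Γ) (hR : IsSqrt R Γ)
    (ψ : HilbertBasis ℕ ℝ H) : Summable fun i => ‖R (ψ i)‖ ^ 2 := by
  simpa only [hR.norm_sq_eq] using hΓ.traceClass ψ

theorem summable_norm_sq_smul_sqrt (hΓ : IsCovarianceOperator Γ) (hR : IsSqrt R Γ)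
    (ψ : HilbertBasis ℕ ℝ H) {c : ℕ → ℝ} {C : ℝ} (hc : ∀ i, |c i| ≤ C) :
    Summable fun i => ‖c i • R (ψ i)‖ ^ 2 := by
  refine Summable.of_nonneg_of_le (fun i => sq_nonneg _) (fun i => ?_)
    ((summable_norm_sq_sqrt hΓ hR ψ).mul_left (C ^ 2))
  rw [norm_smul, mul_pow, Real.norm_eq_abs]
  gcongr
  exact hc i

variable [SecondCountableTopology H] [MeasurableSpace H] [BorelSpace H]
  (μ : Measure H) [IsGaussian μ] {m : H}

theorem coeFn_centredInner (h : H) :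
    centredInner μ h =ᵐ[μ] fun u => ⟪h, u - ∫ x, x ∂μ⟫ := by
  filter_upwards [(innerSL ℝ h).coeFn_compLp (centred μ), MemLp.coeFn_toLp
    ((IsGaussian.memLp_two_id (μ := μ)).sub (memLp_const (∫ x, x ∂μ)))] with u h1 h2
  change ((innerSL ℝ h).compLp (centred μ)) u = _
  rw [h1, centred]
  simp only [innerSL_apply_apply]
  exact congrArg _ h2

variable {μ}

theorem norm_centredInner (hμ : IsGaussianWith μ m Γ) (hR : IsSqrt R Γ) (h : H) :
    ‖centredInner μ h‖ = ‖R h‖ := by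
  rw [← sq_eq_sq₀ (norm_nonneg _) (norm_nonneg _), hR.norm_sq_eq, ← hμ.covariance_eq,
    covarianceBilin_apply IsGaussian.memLp_two_id, ← real_inner_self_eq_norm_sq, L2.inner_def]
  refine integral_congr_ae ?_
  filter_upwards [coeFn_centredInner μ h] with u hu
  simp [hu, sq]

theorem whitened_apply (hΓ : IsCovarianceOperator Γ) (hμ : IsGaussianWith μ m Γ)
    (hR : IsSqrt R Γ) (h : H) : whitened μ R (R h) = centredInner μ h :=
  LinearMap.extendOfNorm_eq (hR.denseRange hΓ)
    ⟨1, fun x => by rw [one_mul]; exact (norm_centredInner hμ hR x).le⟩ h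

theorem norm_whitened (hΓ : IsCovarianceOperator Γ) (hμ : IsGaussianWith μ m Γ)
    (hR : IsSqrt R Γ) (w : H) : ‖whitened μ R w‖ = ‖w‖ := by
  refine (hR.denseRange hΓ).induction_on (p := fun w => ‖whitened μ R w‖ = ‖w‖) w
    (isClosed_eq (by fun_prop) (by fun_prop)) fun h => ?_
  exact (congrArg _ (whitened_apply hΓ hμ hR h)).trans (norm_centredInner hμ hR h)

theorem orthonormal_priorCoord (hΓ : IsCovarianceOperator Γ) (hμ : IsGaussianWith μ m Γ)
    (hR : IsSqrt R Γ) (ψ : HilbertBasis ℕ ℝ H) : Orthonormal ℝ (priorCoord μ R ψ) :=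
  ψ.orthonormal.comp_linearIsometry ⟨(whitened μ R : H →ₗ[ℝ] Lp ℝ 2 μ), norm_whitened hΓ hμ hR⟩

/-- On the dense range of `R` the variable is `⟪h, u - m⟫`, whose characteristic function is known;
both sides are continuous in `w`. -/
theorem integral_exp_whitened (hΓ : IsCovarianceOperator Γ) (hμ : IsGaussianWith μ m Γ)
    (hR : IsSqrt R Γ) (w : H) :
    ∫ u, Complex.exp (whitened μ R w u * Complex.I) ∂μ =
      Complex.exp (-((‖w‖ ^ 2 : ℝ) : ℂ) / 2) := by
  refine (hR.denseRange hΓ).induction_on (p := fun w =>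
    ∫ u, Complex.exp (whitened μ R w u * Complex.I) ∂μ =
      Complex.exp (-((‖w‖ ^ 2 : ℝ) : ℂ) / 2)) w
    (isClosed_eq (continuous_integral_exp.comp (whitened μ R).continuous) (by fun_prop))
    fun h => ?_
  change ∫ u, Complex.exp (whitened μ R (R h) u * Complex.I) ∂μ =
    Complex.exp (-((‖R h‖ ^ 2 : ℝ) : ℂ) / 2)
  rw [whitened_apply hΓ hμ hR, hR.norm_sq_eq, ← hμ.covariance_eq]
  have h1 : ∫ u, Complex.exp (centredInner μ h u * Complex.I) ∂μ =
      ∫ u, Complex.exp (⟪u, h⟫ * Complex.I) * Complex.exp (-(⟪h, ∫ x, x ∂μ⟫ * Complex.I)) ∂μ := by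
    refine integral_congr_ae ?_
    filter_upwards [coeFn_centredInner μ h] with u hu
    rw [hu, ← Complex.exp_add, inner_sub_right, real_inner_comm u h]
    congr 1
    push_cast
    ring
  rw [h1, integral_mul_const, ← charFun_apply, IsGaussian.charFun_eq', ← Complex.exp_add]
  congr 1
  simp only [id]
  ring

/-- A subspace of full measure is dense. -/
theorem dense_of_ae_mem (hΓ : IsCovarianceOperator Γ) (hμ : IsGaussianWith μ m Γ)
    {K : Submodule ℝ H} (hK : ∀ᵐ u ∂μ, u ∈ K) : Dense (K : Set H) := by
  refine dense_of_orthogonal_eq_zero fun v hv => ?_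
  by_contra hne
  -- A functional vanishing on a subspace of full measure has variance zero, against positive
  -- definiteness of `Γ`.
  have h1 : covarianceBilin μ v v = 0 := by
    rw [covarianceBilin_self IsGaussian.memLp_two_id]
    have h2 : (fun u => ⟪v, u⟫) =ᵐ[μ] fun _ => (0 : ℝ) := by
      filter_upwards [hK] with u hu
      rw [real_inner_comm, hv u hu]
    rw [variance_congr h2]
    exact variance_zero μ
  rw [hμ.covariance_eq] at h1
  exact (hΓ.posDef v hne).ne' h1

/-- The coordinates of a diagonal operator applied to the whitened prior. -/
theorem inner_tsum_smulNoise_priorCoord {ψ : HilbertBasis ℕ ℝ H} {c : ℕ → ℝ}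
    (hR : IsSqrt R Γ) (h : Summable (smulNoise μ (fun i => c i • R (ψ i)) (priorCoord μ R ψ)))
    {k w : H} (hw : ∀ i, ⟪ψ i, w⟫ = c i * ⟪ψ i, R k⟫) :
    (innerSL ℝ k).compLp (∑' i, smulNoise μ (fun i => c i • R (ψ i)) (priorCoord μ R ψ) i) =
      whitened μ R w := by
  refine (hasSum_inner_smulNoise h k).unique ?_
  have h1 := (ψ.hasSum_repr w).mapL (whitened μ R)
  convert! h1 using 1
  ext1 i
  rw [map_smul, ψ.repr_apply_apply, hw, real_inner_smul_right, ← hR.isPositive.isSymmetric.apply_clm,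
    real_inner_comm]
  rfl

end Whitened

/-! ### Equivalence of Gaussian laws with diagonal covariance perturbation -/

section Fibre

variable {H : Type*} [NormedAddCommGroup H] [InnerProductSpace ℝ H]

/-- A diagonal affine perturbation of the noise produces an equivalent law. -/
theorem map_noiseSeries_equiv [MeasurableSpace H] [BorelSpace H]
    [SecondCountableTopology H] {e : ℕ → H} {b β t : ℕ → ℝ} (hβ : ∀ i, β i ≠ 0)
    (hsβ : Summable fun i => (β i ^ 2 - 1) ^ 2) (hst : Summable fun i => t i ^ 2)
    (h₁ : Summable (smulNoise stdNoise (fun i => b i • e i) noiseCoord))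
    (h₂ : Summable (smulNoise stdNoise (fun i => (b i * β i) • e i) noiseCoord))
    {S : H} (hS : HasSum (fun i => (b i * t i) • e i) S) (c : H) :
    let X : (ℕ → ℝ) → H :=
      (∑' i, smulNoise stdNoise (fun i => b i • e i) noiseCoord i : Lp H 2 stdNoise)
    let Y : (ℕ → ℝ) → H :=
      (∑' i, smulNoise stdNoise (fun i => (b i * β i) • e i) noiseCoord i : Lp H 2 stdNoise)
    stdNoise.map (fun ω => c + S + Y ω) ≪ stdNoise.map (fun ω => c + X ω) ∧
      stdNoise.map (fun ω => c + X ω) ≪ stdNoise.map (fun ω => c + S + Y ω) := by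
  intro X Y
  let T (ω : ℕ → ℝ) (i : ℕ) : ℝ := β i * ω i + t i
  have hT : Measurable T := by fun_prop
  obtain ⟨hT1, hT2⟩ := stdNoise_map_affine_equiv hβ hsβ hst
  have hX : Measurable fun ω => c + X ω := (Lp.stronglyMeasurable _).measurable.const_add c
  obtain ⟨ms, hms, hmsX⟩ := exists_subseq_tendsto_smulNoise h₁ tendsto_id
  -- Extracted from the subsequence `ms`, so that the partial sums for `X` and `Y` converge along
  -- the same indices.
  obtain ⟨ls, hls, hlsY⟩ := exists_subseq_tendsto_smulNoise h₂ hms.tendsto_atTop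
  -- `X` is given by its series only almost everywhere; evaluating it at `T ω` is legitimate because
  -- the law of `T` is absolutely continuous with respect to `stdNoise`.
  have hXT : ∀ᵐ ω ∂(stdNoise.map T), Tendsto
      (fun k => ∑ i ∈ Finset.range (ms k), ω i • b i • e i) atTop (𝓝 (X ω)) := by
    refine hT1.ae_le ?_
    filter_upwards [hmsX, coeFn_noiseCoord] with ω h3 h4
    simpa only [h4, id] using h3
  have hae : ∀ᵐ ω ∂stdNoise, c + S + Y ω = c + X (T ω) := by
    filter_upwards [ae_of_ae_map hT.aemeasurable hXT, hlsY, coeFn_noiseCoord] with ω h3 h4 h5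
    simp only [h5] at h4
    have h6 := (hS.tendsto_sum_nat.comp (hms.comp hls).tendsto_atTop).add h4
    have h7 := h3.comp hls.tendsto_atTop
    rw [add_assoc]
    refine congrArg _ (tendsto_nhds_unique h6 (h7.congr fun k => ?_))
    simp only [Function.comp_apply]
    rw [← Finset.sum_add_distrib]
    refine Finset.sum_congr rfl fun i _ => ?_
    simp only [T, smul_smul, ← add_smul]
    congr 1
    ring
  have hmap : stdNoise.map (fun ω => c + S + Y ω) = (stdNoise.map T).map fun ω => c + X ω := by
    rw [Measure.map_congr hae, Measure.map_map hX hT]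
    rfl
  rw [hmap]
  exact ⟨hT1.map hX, hT2.map hX⟩

end Fibre

/-! ### Kernels with additive noise -/

section NoiseKernel

variable {H : Type*} [NormedAddCommGroup H] [MeasurableSpace H] [BorelSpace H] [SecondCountableTopology H]

/-- The Markov kernel which adds an independent noise `X` to `M u`. -/
noncomputable def noiseKernel (M : H → H) (X : (ℕ → ℝ) → H) : Kernel H H :=
  (Kernel.id ×ₖ Kernel.const H stdNoise).map fun p => M p.1 + X p.2

variable {M : H → H} {X : (ℕ → ℝ) → H}

theorem noiseKernel_apply (hM : Measurable M) (hX : Measurable X) (u : H) :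
    noiseKernel M X u = stdNoise.map fun ω => M u + X ω := by
  rw [noiseKernel, Kernel.map_apply _ (by fun_prop), Kernel.prod_apply, Kernel.id_apply,
    Kernel.const_apply, Measure.dirac_prod, Measure.map_map (by fun_prop) (by fun_prop)]
  rfl

theorem isMarkovKernel_noiseKernel (hM : Measurable M) (hX : Measurable X) :
    IsMarkovKernel (noiseKernel M X) := by
  rw [noiseKernel]
  exact Kernel.IsMarkovKernel.map _ (by fun_prop)

theorem compProd_noiseKernel (hM : Measurable M) (hX : Measurable X) (μ : Measure H) [SFinite μ] :
    μ ⊗ₘ noiseKernel M X = (μ.prod stdNoise).map fun p => (p.1, M p.1 + X p.2) := by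
  have := isMarkovKernel_noiseKernel hM hX
  ext s hs
  rw [Measure.compProd_apply hs, Measure.map_apply (by fun_prop) hs,
    Measure.prod_apply (by measurability)]
  refine lintegral_congr fun u => ?_
  rw [noiseKernel_apply hM hX, Measure.map_apply (by fun_prop) (by measurability)]
  rfl

end NoiseKernel

/-! ### A reversible Gaussian kernel -/

section Reversible

variable {H : Type*} [NormedAddCommGroup H] [InnerProductSpace ℝ H]

theorem hasSum_sq_inner (ψ : HilbertBasis ℕ ℝ H) (v : H) :
    HasSum (fun i => ⟪ψ i, v⟫ ^ 2) (‖v‖ ^ 2) := by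
  have h := ψ.hasSum_inner_mul_inner v v
  rw [real_inner_self_eq_norm_sq] at h
  convert! h using 1
  ext1 i
  rw [real_inner_comm v, sq]

/-- Stands in for the bounded diagonal operator with eigenvalues `c`, since the modified
coefficients are given only as sequences. -/
theorem exists_inner_eq_mul (ψ : HilbertBasis ℕ ℝ H) {c : ℕ → ℝ} {C : ℝ} (hc : ∀ i, |c i| ≤ C)
    (v : H) : ∃ w : H, ∀ i, ⟪ψ i, w⟫ = c i * ⟪ψ i, v⟫ := by
  have hm : Memℓp (fun i => c i * ⟪ψ i, v⟫) 2 := by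
    refine memℓp_gen ?_
    refine Summable.of_nonneg_of_le (fun i => by positivity) (fun i => ?_)
      ((hasSum_sq_inner ψ v).summable.mul_left (C ^ 2))
    simp only [ENNReal.toReal_ofNat, Real.rpow_ofNat, Real.norm_eq_abs, sq_abs, mul_pow]
    exact mul_le_mul_of_nonneg_right (sq_le_sq' (by linarith [neg_abs_le (c i), hc i]) ((le_abs_self _).trans (hc i)))
      (sq_nonneg _)
  refine ⟨ψ.repr.symm ⟨_, hm⟩, fun i => ?_⟩
  rw [← ψ.repr_apply_apply, LinearIsometryEquiv.apply_symm_apply]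

variable [MeasurableSpace H] [BorelSpace H] [SecondCountableTopology H]
  [CompleteSpace H] {μ : Measure H} [IsGaussian μ] {R Γ : H →L[ℝ] H} {m : H}

/-- The law of `(u, u')`, `u' = m + R A R⁻¹ (u - m) + R B ξ`, through its characteristic function,
when `A² + B² = 1`. -/
theorem integral_exp_joint (hΓ : IsCovarianceOperator Γ) (hμ : IsGaussianWith μ m Γ)
    (hR : IsSqrt R Γ) (ψ : HilbertBasis ℕ ℝ H) {a b : ℕ → ℝ} (hab : ∀ i, a i ^ 2 + b i ^ 2 = 1)
    (h k : H) :
    let Y : H → H :=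
      (∑' i, smulNoise μ (fun i => a i • R (ψ i)) (priorCoord μ R ψ) i : Lp H 2 μ)
    let X : (ℕ → ℝ) → H :=
      (∑' i, smulNoise stdNoise (fun i => b i • R (ψ i)) noiseCoord i : Lp H 2 stdNoise)
    ∫ p, Complex.exp ((⟪h, p.1⟫ + ⟪k, m + Y p.1 + X p.2⟫ : ℝ) * Complex.I) ∂(μ.prod stdNoise) =
      Complex.exp (⟪h + k, m⟫ * Complex.I) * Complex.exp (-((∑' i, (⟪ψ i, R h⟫ ^ 2 +
        2 * a i * ⟪ψ i, R h⟫ * ⟪ψ i, R k⟫ + ⟪ψ i, R k⟫ ^ 2) : ℝ) : ℂ) / 2) := by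
  intro Y X
  have ha (i : ℕ) : |a i| ≤ 1 := by
    rw [← sq_le_one_iff_abs_le_one]; nlinarith [hab i, sq_nonneg (b i)]
  have hb (i : ℕ) : |b i| ≤ 1 := by
    rw [← sq_le_one_iff_abs_le_one]; nlinarith [hab i, sq_nonneg (a i)]
  have hsY := summable_smulNoise (orthonormal_priorCoord hΓ hμ hR ψ)
    (summable_norm_sq_smul_sqrt hΓ hR ψ ha)
  have hsX := summable_smulNoise orthonormal_noiseCoord (summable_norm_sq_smul_sqrt hΓ hR ψ hb)
  obtain ⟨w, hw⟩ := exists_inner_eq_mul ψ ha (R k)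
  obtain ⟨w', hw'⟩ := exists_inner_eq_mul ψ hb (R k)
  have hkb (i : ℕ) : ⟪k, b i • R (ψ i)⟫ = ⟪ψ i, w'⟫ := by
    rw [hw', real_inner_smul_right, ← hR.isPositive.isSymmetric.apply_clm, real_inner_comm]
  have hX : ∫ ω, Complex.exp (⟪k, X ω⟫ * Complex.I) ∂stdNoise =
      Complex.exp (-((‖w'‖ ^ 2 : ℝ) : ℂ) / 2) := by
    rw [integral_exp_noiseSeries hsX]
    · simp_rw [hkb, (hasSum_sq_inner ψ w').tsum_eq]
    · simpa only [hkb] using (hasSum_sq_inner ψ w').summable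
  have hY : ∫ u, Complex.exp ((⟪h, u⟫ + ⟪k, m + Y u⟫ : ℝ) * Complex.I) ∂μ =
      Complex.exp (⟪h + k, m⟫ * Complex.I) * Complex.exp (-((‖R h + w‖ ^ 2 : ℝ) : ℂ) / 2) := by
    rw [← integral_exp_whitened hΓ hμ hR, ← integral_const_mul]
    refine integral_congr_ae ?_
    have h1 := inner_tsum_smulNoise_priorCoord hR hsY hw
    filter_upwards [(innerSL ℝ k).coeFn_compLp
      (∑' i, smulNoise μ (fun i => a i • R (ψ i)) (priorCoord μ R ψ) i),
      Lp.coeFn_add (whitened μ R (R h)) (whitened μ R w), coeFn_centredInner μ h]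
      with u h2 h3 h4
    rw [h1] at h2
    rw [map_add, h3, Pi.add_apply, whitened_apply hΓ hμ hR, h4, h2, ← Complex.exp_add,
      hμ.mean_eq, innerSL_apply_apply]
    congr 1
    simp only [inner_add_right, inner_sub_right, inner_add_left, Y]
    push_cast
    ring
  have hprod : ∫ p, Complex.exp ((⟪h, p.1⟫ + ⟪k, m + Y p.1 + X p.2⟫ : ℝ) * Complex.I)
      ∂(μ.prod stdNoise) =
      (∫ u, Complex.exp ((⟪h, u⟫ + ⟪k, m + Y u⟫ : ℝ) * Complex.I) ∂μ) *
        ∫ ω, Complex.exp (⟪k, X ω⟫ * Complex.I) ∂stdNoise := by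
    rw [← integral_prod_mul]
    refine integral_congr_ae (ae_of_all _ fun p => ?_)
    simp only
    rw [← Complex.exp_add, inner_add_right k (m + Y p.1)]
    congr 1
    push_cast
    ring
  rw [hprod, hX, hY, mul_assoc, ← Complex.exp_add]
  congr 2
  have hs := (hasSum_sq_inner ψ (R h + w)).add (hasSum_sq_inner ψ w')
  -- The signal contributes `aᵢ²` and the noise `bᵢ²` to the coefficient of `⟪ψᵢ, R k⟫²`. Their sum
  -- being 1 makes the exponent symmetric in `h` and `k`, which is reversibility.
  have : ∑' i, (⟪ψ i, R h⟫ ^ 2 + 2 * a i * ⟪ψ i, R h⟫ * ⟪ψ i, R k⟫ + ⟪ψ i, R k⟫ ^ 2) =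
      ‖R h + w‖ ^ 2 + ‖w'‖ ^ 2 := by
    rw [← hs.tsum_eq]
    refine tsum_congr fun i => ?_
    rw [inner_add_right, hw, hw']
    linear_combination -(⟪ψ i, R k⟫ ^ 2) * hab i
  rw [this]
  push_cast
  ring

/-- Reversibility of the autoregressive kernel with `A² + B² = 1`. -/
theorem map_swap_joint (hΓ : IsCovarianceOperator Γ) (hμ : IsGaussianWith μ m Γ)
    (hR : IsSqrt R Γ) (ψ : HilbertBasis ℕ ℝ H) {a b : ℕ → ℝ} (hab : ∀ i, a i ^ 2 + b i ^ 2 = 1) :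
    let Y : H → H :=
      (∑' i, smulNoise μ (fun i => a i • R (ψ i)) (priorCoord μ R ψ) i : Lp H 2 μ)
    let X : (ℕ → ℝ) → H :=
      (∑' i, smulNoise stdNoise (fun i => b i • R (ψ i)) noiseCoord i : Lp H 2 stdNoise)
    (μ ⊗ₘ noiseKernel (fun u => m + Y u) X).map Prod.swap =
      μ ⊗ₘ noiseKernel (fun u => m + Y u) X := by
  intro Y X
  have hYm : Measurable fun u => m + Y u := (Lp.stronglyMeasurable _).measurable.const_add m
  have hXm : Measurable X := (Lp.stronglyMeasurable _).measurable
  rw [compProd_noiseKernel hYm hXm, Measure.map_map measurable_swap (by fun_prop)]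
  have : IsProbabilityMeasure ((μ.prod stdNoise).map fun p => (p.1, m + Y p.1 + X p.2)) :=
    Measure.isProbabilityMeasure_map (by fun_prop)
  have : IsProbabilityMeasure ((μ.prod stdNoise).map
      (Prod.swap ∘ fun p => (p.1, m + Y p.1 + X p.2))) :=
    Measure.isProbabilityMeasure_map (by fun_prop)
  refine Measure.ext_of_charFunDual ?_
  ext1 L
  set h := (InnerProductSpace.toDual ℝ H).symm (L.comp (ContinuousLinearMap.inl ℝ H H)) with hh
  set k := (InnerProductSpace.toDual ℝ H).symm (L.comp (ContinuousLinearMap.inr ℝ H H)) with hk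
  have hL (p : H × H) : L p = ⟪h, p.1⟫ + ⟪k, p.2⟫ := by
    rw [hh, hk, InnerProductSpace.toDual_symm_apply, InnerProductSpace.toDual_symm_apply]
    simp [← map_add]
  rw [charFunDual_apply, charFunDual_apply, integral_map (by fun_prop) (by fun_prop),
    integral_map (by fun_prop) (by fun_prop)]
  simp only [hL, Function.comp_apply, Prod.fst_swap, Prod.snd_swap]
  rw [integral_exp_joint hΓ hμ hR ψ hab h k]
  simp_rw [add_comm ⟪h, m + _ + _⟫]
  rw [integral_exp_joint hΓ hμ hR ψ hab k h, add_comm k h]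
  congr 6
  ext i
  ring

end Reversible

/-! ### Existence and measurability of the gradient of the misfit -/

section Gradient

/-- Applied to the range of `ι`, where continuity is available; passing to a measurable subset of
full measure avoids proving that the range is measurable. -/
theorem aemeasurable_of_continuousOn_of_ae_mem {H : Type*} [TopologicalSpace H]
    [MeasurableSpace H] [BorelSpace H] {μ : Measure H} {E : Type*} [TopologicalSpace E]
    [MeasurableSpace E] [BorelSpace E] {f : H → E} {S : Set H} (hf : ContinuousOn f S)
    (hS : ∀ᵐ u ∂μ, u ∈ S) : AEMeasurable f μ := by
  obtain ⟨T, hT, hTm, hTS⟩ := hS.exists_measurable_mem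
  rw [← Measure.restrict_eq_self_of_ae_mem hT]
  exact (hf.mono hTS).aemeasurable hTm

variable {H : Type*} [NormedAddCommGroup H] [InnerProductSpace ℝ H]
  {X : Type*} [NormedAddCommGroup X] [NormedSpace ℝ X] {N : ℕ} {ι : X →L[ℝ] H}

theorem tendsto_smul_punctured {δ : X} (hδ : δ ≠ 0) :
    Tendsto (fun n : ℕ => (1 / ((n : ℝ) + 1)) • δ) atTop (𝓝[≠] 0) := by
  refine tendsto_nhdsWithin_iff.2 ⟨?_, Eventually.of_forall fun n => ?_⟩
  · simpa using (tendsto_one_div_add_atTop_nhds_zero_nat (𝕜 := ℝ)).smul_const δ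
  · exact smul_ne_zero (by positivity) hδ

/-- Gradients are determined by difference quotients. -/
theorem IsGradientAt.tendsto_quotient (hι : Function.Injective ι) {η : X → ℝ} {x : X} {g : H}
    (h : IsGradientAt ι η x g) (δ : X) :
    Tendsto (fun n : ℕ => ((n : ℝ) + 1) * (η (x + (1 / ((n : ℝ) + 1)) • δ) - η x)) atTop
      (𝓝 ⟪g, ι δ⟫) := by
  rcases eq_or_ne δ 0 with rfl | hδ
  · simp
  have hιδ : ‖ι δ‖ ≠ 0 := norm_ne_zero_iff.2 ((map_ne_zero_iff ι hι).2 hδ)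
  have h1 := (h.comp (tendsto_smul_punctured hδ)).mul_const ‖ι δ‖
  rw [zero_mul] at h1
  rw [tendsto_iff_dist_tendsto_zero]
  refine h1.congr fun n => ?_
  have hn : (0 : ℝ) < (n : ℝ) + 1 := by positivity
  obtain ⟨t, ht⟩ : ∃ t, t = 1 / ((n : ℝ) + 1) := ⟨_, rfl⟩
  have ht0 : 0 < t := by rw [ht]; positivity
  have hnt : (n : ℝ) + 1 = t⁻¹ := by rw [ht, one_div, inv_inv]
  simp only [Function.comp_apply]
  rw [← ht, hnt, map_smul, inner_smul_right, norm_smul, Real.norm_eq_abs, abs_of_pos ht0,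
    Real.dist_eq]
  have h2 : t⁻¹ * (η (x + t • δ) - η x) - ⟪g, ι δ⟫ =
      t⁻¹ * (η (x + t • δ) - η x - t * ⟪g, ι δ⟫) := by
    field_simp
  rw [h2, abs_mul, abs_of_pos (inv_pos.2 ht0)]
  field_simp

variable {F : X → EuclideanSpace ℝ (Fin N)}

theorem ForwardAssumption.exists_local_bound (hF : ForwardAssumption ι F) (x : X) :
    ∃ K > (0 : ℝ), ∀ᶠ δ in 𝓝 (0 : X), ‖F (x + δ) - F x‖ ≤ K * ‖ι δ‖ := by
  obtain ⟨K, hK, h⟩ := hF.lipschitz (‖ι x‖ + 1) (by positivity)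
  refine ⟨K, hK, ?_⟩
  have hc : Tendsto (fun δ : X => ‖ι (x + δ)‖) (𝓝 0) (𝓝 ‖ι (x + 0)‖) :=
    Continuous.tendsto (by fun_prop) _
  rw [add_zero] at hc
  filter_upwards [hc.eventually_lt_const (lt_add_one _)] with δ hδ
  simpa using h (x + δ) x hδ (lt_add_one _)

/-- The derivative of the forward operator is bounded with respect to the norm of `H`. -/
theorem ForwardAssumption.exists_derivative (hF : ForwardAssumption ι F)
    (hι : Function.Injective ι) (x : X) : ∃ J : X →L[ℝ] EuclideanSpace ℝ (Fin N),
      Tendsto (fun δ : X => ‖F (x + δ) - F x - J δ‖ / ‖ι δ‖) (𝓝[≠] 0) (𝓝 0) ∧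
      ∃ K, ∀ δ, ‖J δ‖ ≤ K * ‖ι δ‖ := by
  obtain ⟨J, hJ⟩ := hF.differentiable x
  obtain ⟨K, -, hK⟩ := hF.exists_local_bound x
  refine ⟨J, hJ, K, fun δ => ?_⟩
  rcases eq_or_ne δ 0 with rfl | hδ
  · simp
  have hιδ : 0 < ‖ι δ‖ := norm_pos_iff.2 ((map_ne_zero_iff ι hι).2 hδ)
  have hT := tendsto_smul_punctured hδ
  -- Along `t δ` with `t → 0`, the ratio `‖J (t δ)‖ / ‖ι (t δ)‖` does not depend on `t`, while it is
  -- at most `K` plus a vanishing remainder.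
  have h1 := (hJ.comp hT).const_add K
  rw [add_zero] at h1
  rw [← div_le_iff₀ hιδ]
  refine ge_of_tendsto h1 ?_
  filter_upwards [(hT.mono_right nhdsWithin_le_nhds).eventually hK] with n hn
  have hn0 : (0 : ℝ) < 1 / ((n : ℝ) + 1) := by positivity
  simp only [Function.comp_apply]
  generalize 1 / ((n : ℝ) + 1) = t at hn hn0 ⊢
  simp only [map_smul, norm_smul, Real.norm_eq_abs, abs_of_pos hn0] at hn ⊢
  have h2 : t * ‖J δ‖ ≤ ‖F (x + t • δ) - F x‖ + ‖F (x + t • δ) - F x - t • J δ‖ := by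
    have := norm_sub_le (F (x + t • δ) - F x) (F (x + t • δ) - F x - t • J δ)
    rwa [sub_sub_cancel, norm_smul, Real.norm_eq_abs, abs_of_pos hn0] at this
  rw [div_le_iff₀ hιδ, add_mul, div_mul_eq_mul_div, mul_comm t, mul_comm _ ‖ι δ‖, mul_comm _ ‖ι δ‖,
    mul_div_mul_left _ _ hιδ.ne', mul_comm ‖ι δ‖]
  refine le_of_mul_le_mul_left (a := t) ?_ hn0
  rw [mul_add, mul_div_cancel₀ _ hn0.ne']
  linarith

/-- The misfit has an `H`-gradient at every point. -/
theorem ForwardAssumption.exists_isGradientAt [CompleteSpace H] (hF : ForwardAssumption ι F)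
    (hι : Function.Injective ι) (hd : DenseRange ι) (Γobs : Matrix (Fin N) (Fin N) ℝ)
    (y : EuclideanSpace ℝ (Fin N)) (x : X) : ∃ g, IsGradientAt ι (misfit F Γobs y) x g := by
  obtain ⟨J, hJ, C, hC⟩ := hF.exists_derivative hι x
  obtain ⟨K, hK0, hK⟩ := hF.exists_local_bound x
  let L : EuclideanSpace ℝ (Fin N) →L[ℝ] EuclideanSpace ℝ (Fin N) :=
    Matrix.toEuclideanCLM (𝕜 := ℝ) Γobs⁻¹
  have hη (x' : X) : misfit F Γobs y x' = 1 / 2 * ⟪L (F x' - y), F x' - y⟫ := by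
    rw [misfit, EuclideanSpace.inner_eq_star_dotProduct]
    rfl
  set v := F x - y with hv
  let ℓ : X →L[ℝ] ℝ := (1 / 2 : ℝ) • ((innerSL ℝ (L v)).comp J +
    ((innerSL ℝ v).comp L).comp J)
  have hℓ (δ : X) : ℓ δ = 1 / 2 * (⟪L v, J δ⟫ + ⟪v, L (J δ)⟫) := by
    simp [ℓ, mul_add]
  have hle (e : EuclideanSpace ℝ (Fin N)) :
      |1 / 2 * (⟪L v, e⟫ + ⟪v, L e⟫)| ≤ ‖L‖ * ‖v‖ * ‖e‖ := by
    have h1 := abs_real_inner_le_norm (L v) e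
    have h2 := abs_real_inner_le_norm v (L e)
    have h3 : ‖L v‖ * ‖e‖ ≤ ‖L‖ * ‖v‖ * ‖e‖ := by gcongr; exact L.le_opNorm v
    have h4 : ‖v‖ * ‖L e‖ ≤ ‖v‖ * (‖L‖ * ‖e‖) := by gcongr; exact L.le_opNorm e
    rw [abs_mul, abs_of_pos (by norm_num : (0 : ℝ) < 1 / 2)]
    linarith [abs_add_le ⟪L v, e⟫ ⟪v, L e⟫]
  have hbd (δ : X) : ‖(ℓ : X →ₗ[ℝ] ℝ) δ‖ ≤ ‖L‖ * ‖v‖ * C * ‖(ι : X →ₗ[ℝ] H) δ‖ := by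
    simp only [ContinuousLinearMap.coe_coe, Real.norm_eq_abs]
    rw [hℓ, mul_assoc _ C]
    exact (hle (J δ)).trans (mul_le_mul_of_nonneg_left (hC δ) (by positivity))
  -- The derivative of the misfit is bounded for the norm of `H`, so it extends from the dense image
  -- of `X`, and Riesz representation yields the gradient.
  let ℓ' : H →L[ℝ] ℝ := (ℓ : X →ₗ[ℝ] ℝ).extendOfNorm (ι : X →ₗ[ℝ] H)
  have hℓ' (δ : X) : ℓ' (ι δ) = ℓ δ := LinearMap.extendOfNorm_eq hd ⟨_, hbd⟩ δ
  refine ⟨(InnerProductSpace.toDual ℝ H).symm ℓ', ?_⟩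
  have hι0 : Tendsto (fun δ : X => ‖ι δ‖) (𝓝[≠] 0) (𝓝 0) := by
    have : Tendsto (fun δ : X => ‖ι δ‖) (𝓝 0) (𝓝 ‖ι 0‖) := Continuous.tendsto (by fun_prop) _
    rw [map_zero, norm_zero] at this
    exact this.mono_left nhdsWithin_le_nhds
  have hlim := (hJ.const_mul (‖L‖ * ‖v‖)).add (hι0.const_mul (1 / 2 * ‖L‖ * K ^ 2))
  rw [mul_zero, mul_zero, add_zero] at hlim
  refine squeeze_zero' (Eventually.of_forall fun δ => by positivity) ?_ hlim
  filter_upwards [nhdsWithin_le_nhds hK, self_mem_nhdsWithin] with δ h1 h0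
  have hιδ : 0 < ‖ι δ‖ := norm_pos_iff.2 ((map_ne_zero_iff ι hι).2 h0)
  rw [div_le_iff₀ hιδ, add_mul, mul_div_assoc', div_mul_cancel₀ _ hιδ.ne',
    InnerProductSpace.toDual_symm_apply, hℓ', hℓ, hη, hη]
  set e := F (x + δ) - F x with he
  have hev : F (x + δ) - y = v + e := by rw [hv, he]; abel
  have hexp : 1 / 2 * ⟪L (F (x + δ) - y), F (x + δ) - y⟫ - 1 / 2 * ⟪L v, v⟫ -
      1 / 2 * (⟪L v, J δ⟫ + ⟪v, L (J δ)⟫) =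
      1 / 2 * (⟪L v, e - J δ⟫ + ⟪v, L (e - J δ)⟫) + 1 / 2 * ⟪L e, e⟫ := by
    rw [hev]
    simp only [map_add, map_sub, inner_add_left, inner_add_right, inner_sub_right]
    rw [real_inner_comm v (L e)]
    ring
  rw [hexp]
  refine (abs_add_le _ _).trans (add_le_add (hle _) ?_)
  have h5 : |⟪L e, e⟫| ≤ ‖L‖ * ‖e‖ * ‖e‖ :=
    (abs_real_inner_le_norm _ _).trans (by gcongr; exact L.le_opNorm e)
  have h6 : ‖e‖ * ‖e‖ ≤ (K * ‖ι δ‖) * (K * ‖ι δ‖) :=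
    mul_le_mul h1 h1 (norm_nonneg _) (by positivity)
  rw [abs_mul, abs_of_pos (by norm_num : (0 : ℝ) < 1 / 2)]
  nlinarith [norm_nonneg L]

theorem isGradientAt_gradientAt {η : X → ℝ} {x : X} (h : ∃ g, IsGradientAt ι η x g) :
    IsGradientAt ι η x (gradientAt ι η x) := by
  rw [gradientAt, dif_pos h]
  exact h.choose_spec

theorem ForwardAssumption.continuousOn_extend (hF : ForwardAssumption ι F)
    (hι : Function.Injective ι) : ContinuousOn (Function.extend ι F 0) (Set.range ι) := by
  rintro _ ⟨x, rfl⟩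
  obtain ⟨K, -, h⟩ := hF.lipschitz (‖ι x‖ + 1) (by positivity)
  rw [ContinuousWithinAt, tendsto_iff_norm_sub_tendsto_zero]
  have h1 : Tendsto (fun u => K * ‖u - ι x‖) (𝓝[Set.range ι] (ι x)) (𝓝 0) := by
    have : Tendsto (fun u => K * ‖u - ι x‖) (𝓝 (ι x)) (𝓝 (K * ‖ι x - ι x‖)) :=
      Continuous.tendsto (by fun_prop) _
    rw [sub_self, norm_zero, mul_zero] at this
    exact this.mono_left nhdsWithin_le_nhds
  refine squeeze_zero' (Eventually.of_forall fun u => norm_nonneg _) ?_ h1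
  have h2 : ∀ᶠ u in 𝓝 (ι x), ‖u‖ < ‖ι x‖ + 1 :=
    (continuous_norm.tendsto _).eventually_lt_const (lt_add_one _)
  filter_upwards [nhdsWithin_le_nhds h2, self_mem_nhdsWithin] with u hu hur
  obtain ⟨x', rfl⟩ := hur
  rw [hι.extend_apply, hι.extend_apply]
  exact h x' x hu (lt_add_one _)

theorem ForwardAssumption.continuousOn_extend_misfit (hF : ForwardAssumption ι F)
    (hι : Function.Injective ι) (Γobs : Matrix (Fin N) (Fin N) ℝ)
    (y : EuclideanSpace ℝ (Fin N)) :
    ContinuousOn (Function.extend ι (misfit F Γobs y) 0) (Set.range ι) := by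
  have hq : Continuous fun v : EuclideanSpace ℝ (Fin N) =>
      (1 / 2 : ℝ) * ((v - y).ofLp ⬝ᵥ (Γobs⁻¹ *ᵥ (v - y).ofLp)) := by
    fun_prop
  refine (hq.comp_continuousOn (hF.continuousOn_extend hι)).congr ?_
  rintro _ ⟨x, rfl⟩
  simp only [Function.comp_apply, hι.extend_apply, misfit]

variable [MeasurableSpace H] [BorelSpace H] {μ : Measure H}

theorem aemeasurable_of_inner [SecondCountableTopology H] (ψ : HilbertBasis ℕ ℝ H)
    {f : H → H} (h : ∀ i, AEMeasurable (fun u => ⟪ψ i, f u⟫) μ) : AEMeasurable f μ := by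
  refine aemeasurable_of_tendsto_metrizable_ae atTop
    (f := fun n u => ∑ i ∈ Finset.range n, ⟪ψ i, f u⟫ • ψ i) (fun n => ?_)
    (ae_of_all _ fun u => ?_)
  · exact Finset.aemeasurable_fun_sum _ fun i _ => (h i).smul_const _
  · simpa only [ψ.repr_apply_apply] using (ψ.hasSum_repr (f u)).tendsto_sum_nat

/-- The gradient of the misfit is almost everywhere measurable. -/
theorem aemeasurable_gradientAt [CompleteSpace H] [SecondCountableTopology H]
    (hF : ForwardAssumption ι F) (hι : Function.Injective ι) (hd : DenseRange ι)
    (hX : ∀ᵐ u ∂μ, u ∈ Set.range ι) (Γobs : Matrix (Fin N) (Fin N) ℝ)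
    (y : EuclideanSpace ℝ (Fin N)) (ψ : HilbertBasis ℕ ℝ H) :
    AEMeasurable (Function.extend ι (gradientAt ι (misfit F Γobs y)) 0) μ := by
  set f := Function.extend ι (gradientAt ι (misfit F Γobs y)) 0 with hf
  set η' := Function.extend ι (misfit F Γobs y) 0 with hη'
  have hη := hF.continuousOn_extend_misfit hι Γobs y
  -- A pointwise limit, on the range of `ι`, of difference quotients that are continuous there. This
  -- also bypasses the choice made in `gradientAt`.
  have h1 (δ : X) : AEMeasurable (fun u => ⟪f u, ι δ⟫) μ := by
    refine aemeasurable_of_tendsto_metrizable_ae atTop (f := fun (n : ℕ) u =>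
      ((n : ℝ) + 1) * (η' (u + ι ((1 / ((n : ℝ) + 1)) • δ)) - η' u)) (fun n => ?_) ?_
    · refine aemeasurable_of_continuousOn_of_ae_mem
        (continuousOn_const.mul (ContinuousOn.sub (hη.comp (by fun_prop) ?_) hη)) hX
      rintro _ ⟨x, rfl⟩
      exact ⟨x + (1 / ((n : ℝ) + 1)) • δ, map_add ι _ _⟩
    · filter_upwards [hX] with u hu
      obtain ⟨x, rfl⟩ := hu
      simp only [← map_add, hη', hf, hι.extend_apply]
      exact (isGradientAt_gradientAt
        (hF.exists_isGradientAt hι hd Γobs y x)).tendsto_quotient hι δ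
  refine aemeasurable_of_inner ψ fun i => ?_
  -- The basis vectors need not lie in the image of `X`, so they are approximated from it.
  obtain ⟨d, hd1, hd2⟩ := mem_closure_iff_seq_limit.1 (hd (ψ i))
  choose δ hδ using hd1
  refine aemeasurable_of_tendsto_metrizable_ae atTop (f := fun n u => ⟪f u, ι (δ n)⟫)
    (fun n => h1 (δ n)) (ae_of_all _ fun u => ?_)
  simp only [hδ]
  rw [real_inner_comm]
  exact tendsto_const_nhds.inner hd2

end Gradient

/-! ### The proposal kernel and its reversible reference kernel -/

theorem exists_reversible_coefficients {a b : ℕ → ℝ} (hzero : ∀ i, b i = 0 → a i = 1)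
    {c : ℝ} (hc : 0 < c) (hlow : ∀ i, b i ≠ 0 → c ≤ |b i|)
    (hsum : Summable fun i => (a i ^ 2 + b i ^ 2 - 1) ^ 2) :
    ∃ a' b' β : ℕ → ℝ, ∃ κ > (0 : ℝ), (∀ i, a' i ^ 2 + b' i ^ 2 = 1) ∧
      {i | a' i ≠ a i}.Finite ∧ (∀ i, β i ≠ 0) ∧ (∀ i, b' i * β i = b i) ∧
      (∀ i, b i ≠ 0 → κ ≤ b' i) ∧ (∀ i, b i = 0 → a' i = 1) ∧
      Summable fun i => (β i ^ 2 - 1) ^ 2 := by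
  -- Keep `aᵢ` unless this would make `b'ᵢ = √(1 - a'ᵢ²)` too small on a noisy coordinate; there 0
  -- is a safe substitute.
  let a' (i : ℕ) : ℝ := if b i = 0 then 1 else if a i ^ 2 ≤ 1 - c ^ 2 / 2 then a i else 0
  let b' (i : ℕ) : ℝ := √(1 - a' i ^ 2)
  -- Without noise `b'ᵢ` is also 0, so any nonzero factor is consistent; 1 contributes nothing to
  -- the sum.
  let β (i : ℕ) : ℝ := if b i = 0 then 1 else b i / b' i
  have hmin : 0 < min (c ^ 2 / 2) 1 := lt_min (by positivity) one_pos
  have hκ : 0 < √(min (c ^ 2 / 2) 1) := Real.sqrt_pos.2 hmin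
  have ha0 (i : ℕ) (hi : b i = 0) : a' i = 1 := if_pos hi
  have ha1 (i : ℕ) (hi : b i ≠ 0) : min (c ^ 2 / 2) 1 ≤ 1 - a' i ^ 2 := by
    simp only [a', hi, if_false]
    split_ifs with h
    · exact (min_le_left _ _).trans (by linarith)
    · exact (min_le_right _ _).trans (by norm_num)
  have ha2 (i : ℕ) : 0 ≤ 1 - a' i ^ 2 := by
    by_cases hi : b i = 0
    · rw [ha0 i hi]; norm_num
    · exact hmin.le.trans (ha1 i hi)
  have hb1 (i : ℕ) : a' i ^ 2 + b' i ^ 2 = 1 := by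
    rw [Real.sq_sqrt (ha2 i)]; ring
  have hb2 (i : ℕ) (hi : b i ≠ 0) : √(min (c ^ 2 / 2) 1) ≤ b' i := Real.sqrt_le_sqrt (ha1 i hi)
  have hb3 (i : ℕ) (hi : b i ≠ 0) : 0 < b' i := hκ.trans_le (hb2 i hi)
  have hfin : {i | a' i ≠ a i}.Finite := by
    -- All but finitely many `i` satisfy `|aᵢ² + bᵢ² - 1| < c²/2`; with `bᵢ² ≥ c²` this forces `aᵢ²
    -- < 1 - c²/2`.
    have h1 := hsum.tendsto_cofinite_zero.eventually_lt_const
      (show (0 : ℝ) < (c ^ 2 / 2) ^ 2 by positivity)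
    refine Set.Finite.subset (eventually_cofinite.1 h1) fun i hi hlt => hi ?_
    by_cases hbi : b i = 0
    · rw [ha0 i hbi, hzero i hbi]
    · simp only [a', hbi, if_false]
      refine if_pos ?_
      have h2 : c ^ 2 ≤ b i ^ 2 := by
        rw [← sq_abs (b i)]; exact pow_le_pow_left₀ hc.le (hlow i hbi) 2
      have h3 := abs_lt_of_sq_lt_sq hlt (by positivity)
      linarith [(abs_lt.1 h3).2]
  have hβb (i : ℕ) : b' i * β i = b i := by
    by_cases hi : b i = 0
    · simp [b', ha0 i hi, hi]
    · simp only [β, hi, if_false]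
      exact mul_div_cancel₀ _ (hb3 i hi).ne'
  refine ⟨a', b', β, _, hκ, hb1, hfin, fun i => ?_, hβb, hb2, ha0, ?_⟩
  · by_cases hi : b i = 0
    · simp [β, hi]
    · simp only [β, hi, if_false]
      exact div_ne_zero hi (hb3 i hi).ne'
  · refine Summable.of_norm_bounded_eventually
      (hsum.mul_left (1 / min (c ^ 2 / 2) 1 ^ 2)) ?_
    filter_upwards [eventually_cofinite.2 hfin] with i hi
    rw [Real.norm_eq_abs, abs_of_nonneg (sq_nonneg _)]
    by_cases hbi : b i = 0
    · simp only [β, hbi, if_true]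
      norm_num
      positivity
    · have h1 : min (c ^ 2 / 2) 1 ≤ b' i ^ 2 := by
        rw [Real.sq_sqrt (ha2 i)]; exact ha1 i hbi
      have h2 : β i ^ 2 - 1 = (a i ^ 2 + b i ^ 2 - 1) / b' i ^ 2 := by
        have := (hb3 i hbi).ne'
        rw [← hi, ← hβb i]
        field_simp
        linear_combination -hb1 i
      rw [h2, div_pow, div_eq_mul_one_div, mul_comm]
      gcongr

section Proposal

variable {H : Type*} [NormedAddCommGroup H] [InnerProductSpace ℝ H]

theorem noiseTerm_eq_smulNoise {Ω : Type*} [MeasurableSpace Ω] (P : Measure Ω)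
    {ψ : HilbertBasis ℕ ℝ H} (R : H →L[ℝ] H) {D : H →L[ℝ] H} {d : ℕ → ℝ}
    (hD : ∀ i, D (ψ i) = d i • ψ i) (z : ℕ → Lp ℝ 2 P) :
    noiseTerm P ψ (R ∘L D) z = smulNoise P (fun i => d i • R (ψ i)) z := by
  ext1 i
  rw [noiseTerm, smulNoise, ContinuousLinearMap.comp_apply, hD, map_smul]

theorem inner_diagonal_apply [CompleteSpace H] {ψ : HilbertBasis ℕ ℝ H} {D : H →L[ℝ] H}
    {d : ℕ → ℝ} (hsa : IsSelfAdjoint D) (hD : ∀ i, D (ψ i) = d i • ψ i) (i : ℕ) (v : H) :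
    ⟪ψ i, D v⟫ = d i * ⟪ψ i, v⟫ := by
  rw [← hsa.isSymmetric.apply_clm, hD, real_inner_smul_left]

/-- Changing finitely many coefficients changes the sum by a finite combination of the `eᵢ`. For `eᵢ
= R ψᵢ` the change thus lies in the range of `R`, an admissible shift. -/
theorem coeFn_tsum_smulNoise_of_finite {Ω : Type*} [MeasurableSpace Ω] {P : Measure Ω}
    {e : ℕ → H} {z : ℕ → Lp ℝ 2 P} {a a' : ℕ → ℝ} (hfin : {i | a' i ≠ a i}.Finite)
    (h : Summable (smulNoise P (fun i => a i • e i) z))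
    (h' : Summable (smulNoise P (fun i => a' i • e i) z)) :
    ∀ᵐ ω ∂P, (∑' i, smulNoise P (fun i => a i • e i) z i : Lp H 2 P) ω =
      (∑' i, smulNoise P (fun i => a' i • e i) z i : Lp H 2 P) ω +
        ∑ i ∈ hfin.toFinset, ((a i - a' i) * z i ω) • e i := by
  have h1 := (h.hasSum.sub h'.hasSum).unique
    (hasSum_sum_of_ne_finset_zero (s := hfin.toFinset) fun i hi => by
      have : a' i = a i := by simpa using hi
      simp [smulNoise, this])
  rw [sub_eq_iff_eq_add'] at h1
  rw [h1]
  have h2 : ∀ᵐ ω ∂P, ∀ i, (smulNoise P (fun i => a i • e i) z i -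
      smulNoise P (fun i => a' i • e i) z i : Lp H 2 P) ω = ((a i - a' i) * z i ω) • e i := by
    refine ae_all_iff.2 fun i => ?_
    filter_upwards [Lp.coeFn_sub (smulNoise P (fun i => a i • e i) z i)
      (smulNoise P (fun i => a' i • e i) z i), coeFn_smulNoise (fun i => a i • e i) z i,
      coeFn_smulNoise (fun i => a' i • e i) z i] with ω h3 h4 h5
    rw [h3, Pi.sub_apply, h4, h5, smul_smul, smul_smul, ← sub_smul]
    congr 1
    ring
  filter_upwards [h2, Lp.coeFn_add (∑' i, smulNoise P (fun i => a' i • e i) z i)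
    (∑ i ∈ hfin.toFinset, (smulNoise P (fun i => a i • e i) z i -
      smulNoise P (fun i => a' i • e i) z i)), Lp.coeFn_finsetSum hfin.toFinset fun i =>
      smulNoise P (fun i => a i • e i) z i - smulNoise P (fun i => a' i • e i) z i] with ω h3 h4 h5
  rw [h4, Pi.add_apply, h5, Finset.sum_apply]
  simp only [h3]

variable [CompleteSpace H] [SecondCountableTopology H] [MeasurableSpace H] [BorelSpace H]
  {X : Type*} [NormedAddCommGroup X] [NormedSpace ℝ X]
  {μ : Measure H} [IsGaussian μ] {R A B G : H →L[ℝ] H} {ψ : HilbertBasis ℕ ℝ H} {vref : H}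
  {ι : X →L[ℝ] H} {η : X → ℝ}

theorem aemeasurable_proposalMean
    (hgrad : AEMeasurable (Function.extend ι (gradientAt ι η) 0) μ) :
    AEMeasurable (proposalMean μ R A G ψ vref ι η) μ := by
  have h1 : Measurable (applyNoise μ ψ (R ∘L A) (priorCoord μ R ψ)) :=
    (Lp.stronglyMeasurable _).measurable
  have h2 : Measurable fun v => R (G (R v)) := by fun_prop
  exact ((h1.aemeasurable.sub_const _).add_const _).sub (h2.comp_aemeasurable hgrad)

theorem exists_isProposalKernel
    (hgrad : AEMeasurable (Function.extend ι (gradientAt ι η) 0) μ) :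
    ∃ q : Kernel H H, IsProposalKernel μ R A B G ψ vref ι η q := by
  have hM : AEMeasurable (proposalMean μ R A G ψ vref ι η) μ := aemeasurable_proposalMean hgrad
  have hX : Measurable (applyNoise stdNoise ψ (R ∘L B) noiseCoord) :=
    (Lp.stronglyMeasurable _).measurable
  refine ⟨noiseKernel (hM.mk _) (applyNoise stdNoise ψ (R ∘L B) noiseCoord),
    isMarkovKernel_noiseKernel hM.measurable_mk hX, ?_⟩
  filter_upwards [hM.ae_eq_mk] with u hu
  rw [noiseKernel_apply hM.measurable_mk hX, proposalLaw, hu]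

/-- The proposal laws are equivalent to those of a kernel which is reversible for the prior. -/
theorem proposalLaw_equiv {m : H} {Γ : H →L[ℝ] H} (hΓ : IsCovarianceOperator Γ)
    (hμ : IsGaussianWith μ m Γ) (hR : IsSqrt R Γ) {a b g a' b' β : ℕ → ℝ} {κ C : ℝ} (hκ : 0 < κ)
    (hA : IsSelfAdjoint A) (hG : IsSelfAdjoint G) (hAψ : ∀ i, A (ψ i) = a i • ψ i)
    (hBψ : ∀ i, B (ψ i) = b i • ψ i) (hGψ : ∀ i, G (ψ i) = g i • ψ i)
    (hCa : ∀ i, |a i| ≤ C) (hCb : ∀ i, |b i| ≤ C) (hzero : ∀ i, b i = 0 → a i = 1 ∧ g i = 0)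
    (hab : ∀ i, a' i ^ 2 + b' i ^ 2 = 1) (hfin : {i | a' i ≠ a i}.Finite) (hβ : ∀ i, β i ≠ 0)
    (hβb : ∀ i, b' i * β i = b i) (hκb : ∀ i, b i ≠ 0 → κ ≤ b' i)
    (hzero' : ∀ i, b i = 0 → a' i = 1) (hsβ : Summable fun i => (β i ^ 2 - 1) ^ 2) :
    let Y : H → H :=
      (∑' i, smulNoise μ (fun i => a' i • R (ψ i)) (priorCoord μ R ψ) i : Lp H 2 μ)
    let Z : (ℕ → ℝ) → H :=
      (∑' i, smulNoise stdNoise (fun i => b' i • R (ψ i)) noiseCoord i : Lp H 2 stdNoise)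
    ∀ᵐ u ∂μ, proposalLaw μ R A B G ψ vref ι η u ≪ noiseKernel (fun u => m + Y u) Z u ∧
      noiseKernel (fun u => m + Y u) Z u ≪ proposalLaw μ R A B G ψ vref ι η u := by
  intro Y Z
  have ha' (i : ℕ) : |a' i| ≤ 1 := by
    rw [← sq_le_one_iff_abs_le_one]; nlinarith [hab i, sq_nonneg (b' i)]
  have hb' (i : ℕ) : |b' i| ≤ 1 := by
    rw [← sq_le_one_iff_abs_le_one]; nlinarith [hab i, sq_nonneg (a' i)]
  have hz := orthonormal_priorCoord hΓ hμ hR ψ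
  have hsA := summable_smulNoise hz (summable_norm_sq_smul_sqrt hΓ hR ψ hCa)
  have hsA' := summable_smulNoise hz (summable_norm_sq_smul_sqrt hΓ hR ψ ha')
  have hsB := summable_smulNoise orthonormal_noiseCoord
    (summable_norm_sq_smul_sqrt hΓ hR ψ hCb)
  have hsB' := summable_smulNoise orthonormal_noiseCoord
    (summable_norm_sq_smul_sqrt hΓ hR ψ hb')
  have hYm : Measurable fun u => m + Y u := (Lp.stronglyMeasurable _).measurable.const_add m
  have hZm : Measurable Z := (Lp.stronglyMeasurable _).measurable
  -- Chosen so that `R (S u)` is the difference between the mean of the proposal and that of the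
  -- reversible kernel.
  let S (u : H) : H := ∑ i ∈ hfin.toFinset, ((a i - a' i) * priorCoord μ R ψ i u) • ψ i +
    (vref - A vref - G (R (Function.extend ι (gradientAt ι η) 0 u)))
  -- On a coordinate without noise no shift can be absorbed: `aᵢ = a'ᵢ = 1` cancels the correction
  -- and the `vref` terms, and `gᵢ = 0` the gradient term.
  have hS0 (u : H) (i : ℕ) (hi : b i = 0) : ⟪ψ i, S u⟫ = 0 := by
    simp only [S, inner_add_right, inner_sub_right, inner_diagonal_apply hA hAψ,
      inner_diagonal_apply hG hGψ, inner_sum, real_inner_smul_right, (hzero i hi).1,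
      (hzero i hi).2]
    rw [Finset.sum_eq_zero]
    · ring
    · intro j hj
      by_cases hij : i = j
      · subst hij
        simp [(hzero i hi).1, hzero' i hi]
      · rw [ψ.orthonormal.2 hij, mul_zero]
  filter_upwards [coeFn_tsum_smulNoise_of_finite hfin hsA hsA'] with u hu
  have hmean : proposalMean μ R A G ψ vref ι η u = m + Y u + R (S u) := by
    rw [proposalMean, applyNoise, noiseTerm_eq_smulNoise μ R hAψ, hu, hμ.mean_eq]
    simp only [S, map_add, map_sub, map_sum, map_smul, Y]
    abel
  let t (i : ℕ) : ℝ := ⟪ψ i, S u⟫ / b' i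
  have hbt (i : ℕ) : b' i * t i = ⟪ψ i, S u⟫ := by
    by_cases hi : b i = 0
    · simp [t, hS0 u i hi]
    · exact mul_div_cancel₀ _ (hκ.trans_le (hκb i hi)).ne'
  have hst : Summable fun i => t i ^ 2 := by
    refine Summable.of_nonneg_of_le (fun i => sq_nonneg _) (fun i => ?_)
      ((hasSum_sq_inner ψ (S u)).summable.mul_left (1 / κ ^ 2))
    by_cases hi : b i = 0
    · simp only [t, hS0 u i hi]
      simp
    · rw [div_pow, div_eq_mul_one_div, mul_comm]
      have := hκb i hi
      gcongr
  have hRS : HasSum (fun i => (b' i * t i) • R (ψ i)) (R (S u)) := by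
    simpa only [hbt, ψ.repr_apply_apply, map_smul] using (ψ.hasSum_repr (S u)).mapL R
  have key := map_noiseSeries_equiv hβ hsβ hst hsB' (by simpa only [hβb] using hsB) hRS (m + Y u)
  simp only [hβb] at key
  rw [noiseKernel_apply hYm hZm, proposalLaw, hmean, applyNoise,
    noiseTerm_eq_smulNoise stdNoise R hBψ]
  exact key

end Proposal

end OpWeighted

open OpWeighted in
theorem theorem1 {H : Type*} [NormedAddCommGroup H] [InnerProductSpace ℝ H] [CompleteSpace H]
    [SecondCountableTopology H] [MeasurableSpace H] [BorelSpace H]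
    {X : Type*} [NormedAddCommGroup X] [NormedSpace ℝ X] [CompleteSpace X] {N : ℕ}
    -- the Gaussian prior `N(m₀, Γ)` and the square root `R` of `Γ`
    (μ₀ : Measure H) [IsGaussian μ₀] (m₀ : H) (Γ R : H →L[ℝ] H)
    (hΓ : IsCovarianceOperator Γ) (hμ₀ : IsGaussianWith μ₀ m₀ Γ) (hR : IsSqrt R Γ)
    -- the forward operator on a Banach space of full prior measure, noise covariance and data
    (ι : X →L[ℝ] H) (hι : Function.Injective ι) (hX : ∀ᵐ u ∂μ₀, u ∈ Set.range ι)
    (F : X → EuclideanSpace ℝ (Fin N)) (hF : ForwardAssumption ι F)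
    (Γobs : Matrix (Fin N) (Fin N) ℝ) (hΓobs : Γobs.PosDef) (y : EuclideanSpace ℝ (Fin N))
    -- the posterior is equivalent to the prior
    (hpost : posterior μ₀ ι F Γobs y ≪ μ₀) (hprior : μ₀ ≪ posterior μ₀ ι F Γobs y)
    -- the reference point `u_ref = m₀ + R vref` and the operators of the proposal
    (vref : H) (A B G : H →L[ℝ] H)
    (hA : IsSelfAdjoint A) (hB : IsSelfAdjoint B) (hG : IsSelfAdjoint G)
    (ψ : HilbertBasis ℕ ℝ H) (a b g : ℕ → ℝ)
    (hAψ : ∀ i, A (ψ i) = a i • ψ i) (hBψ : ∀ i, B (ψ i) = b i • ψ i)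
    (hGψ : ∀ i, G (ψ i) = g i • ψ i)
    -- the conditions on the eigenvalues
    (hbdd : ∃ C : ℝ, ∀ i, |a i| < C ∧ |b i| < C ∧ |g i| < C)
    (hzero : ∀ i, b i = 0 → a i = 1 ∧ g i = 0)
    (hlow : ∃ c > (0 : ℝ), ∀ i, b i ≠ 0 → c ≤ |b i|)
    (hsum : Summable fun i => (a i ^ 2 + b i ^ 2 - 1) ^ 2) :
    -- the proposal makes sense: the series for `R A R⁻¹ (u - m₀)` and `R B ξ` converge, and the
    -- proposal distributions form a Markov kernel
    Summable (noiseTerm μ₀ ψ (R ∘L A) (priorCoord μ₀ R ψ)) ∧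
    Summable (noiseTerm stdNoise ψ (R ∘L B) noiseCoord) ∧
    (∃ q : Kernel H H, IsProposalKernel μ₀ R A B G ψ vref ι (misfit F Γobs y) q) ∧
    -- the measures `ν^⊥` and `ν` of the Metropolis-Hastings algorithm for the posterior are
    -- mutually absolutely continuous
    ∀ q : Kernel H H, IsProposalKernel μ₀ R A B G ψ vref ι (misfit F Γobs y) q →
      mhBackward (posterior μ₀ ι F Γobs y) q ≪ mhForward (posterior μ₀ ι F Γobs y) q ∧
      mhForward (posterior μ₀ ι F Γobs y) q ≪ mhBackward (posterior μ₀ ι F Γobs y) q := by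
  obtain ⟨C, hC⟩ := hbdd
  obtain ⟨c, hc, hlow⟩ := hlow
  have hCa (i : ℕ) : |a i| ≤ C := (hC i).1.le
  have hCb (i : ℕ) : |b i| ≤ C := (hC i).2.1.le
  have hd : DenseRange ι := by
    have hK : ∀ᵐ u ∂μ₀, u ∈ LinearMap.range (ι : X →ₗ[ℝ] H) := by
      simpa using! hX
    simpa [DenseRange] using! dense_of_ae_mem hΓ hμ₀ hK
  have hgrad := aemeasurable_gradientAt hF hι hd hX Γobs y ψ
  refine ⟨?_, ?_, exists_isProposalKernel hgrad, fun q hq => ?_⟩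
  · rw [noiseTerm_eq_smulNoise μ₀ R hAψ]
    exact summable_smulNoise (orthonormal_priorCoord hΓ hμ₀ hR ψ)
      (summable_norm_sq_smul_sqrt hΓ hR ψ hCa)
  · rw [noiseTerm_eq_smulNoise stdNoise R hBψ]
    exact summable_smulNoise orthonormal_noiseCoord (summable_norm_sq_smul_sqrt hΓ hR ψ hCb)
  obtain ⟨a', b', β, κ, hκ, hab, hfin, hβ, hβb, hκb, hzero', hsβ⟩ :=
    exists_reversible_coefficients (fun i hi => (hzero i hi).1) hc hlow hsum
  have hrev := map_swap_joint hΓ hμ₀ hR ψ hab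
  have hequiv := proposalLaw_equiv (vref := vref) (ι := ι) (η := misfit F Γobs y) hΓ hμ₀ hR hκ
    hA hG hAψ hBψ hGψ hCa hCb hzero hab hfin hβ hβb hκb hzero' hsβ
  simp only at hrev hequiv
  have hmk := isMarkovKernel_noiseKernel
    (M := fun u => m₀ + (∑' i, smulNoise μ₀ (fun i => a' i • R (ψ i)) (priorCoord μ₀ R ψ) i :
      Lp H 2 μ₀) u)
    (X := (∑' i, smulNoise stdNoise (fun i => b' i • R (ψ i)) noiseCoord i : Lp H 2 stdNoise))
    ((Lp.stronglyMeasurable _).measurable.const_add m₀) (Lp.stronglyMeasurable _).measurable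
  set q' := noiseKernel
    (fun u => m₀ + (∑' i, smulNoise μ₀ (fun i => a' i • R (ψ i)) (priorCoord μ₀ R ψ) i :
      Lp H 2 μ₀) u)
    (∑' i, smulNoise stdNoise (fun i => b' i • R (ψ i)) noiseCoord i : Lp H 2 stdNoise)
  have := hq.isMarkov
  have : SFinite (posterior μ₀ ι F Γobs y) := by
    unfold OpWeighted.posterior
    infer_instance
  -- Both the first marginals and almost all fibres are compared; the fibre statement, known
  -- `μ₀`-almost everywhere, is transferred to the posterior.
  have h1 : posterior μ₀ ι F Γobs y ⊗ₘ q ≪ μ₀ ⊗ₘ q' := by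
    refine hpost.compProd (hpost.ae_le ?_)
    filter_upwards [hq.law_eq, hequiv] with u h2 h3
    exact h2 ▸ h3.1
  have h2 : μ₀ ⊗ₘ q' ≪ posterior μ₀ ι F Γobs y ⊗ₘ q := by
    refine hprior.compProd ?_
    filter_upwards [hq.law_eq, hequiv] with u h2 h3
    exact h2 ▸ h3.2
  refine ⟨?_, ?_⟩
  -- Swapping the comparison leaves its reversible side fixed, so it links `ν^⊥` to `ν`.
  · have h3 := h1.map measurable_swap
    rw [hrev] at h3
    exact h3.trans h2
  · have h3 := h2.map measurable_swap
    rw [hrev] at h3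
    exact h1.trans h3
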